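/- Let $d\ge 1$ be an integer and $\mu_1,\mu_2\in\mathbb R$, and set $$\mu:=\frac{\mu_1(2-\mu_1)}{4}+\mu_2,\qquad \nu:=\tfrac12\sqrt{1-4\mu}\ \text{ if }\mu\le\tfrac14,\qquad \nu:=\tfrac i2\sqrt{4\mu-1}\ \text{ if }\mu>\tfrac14 .$$ Assume $\mu\ge 0$. Let $\dot H^1(\mathbb R^d)$ be the completion of the Schwartz space for the norm $\|\nabla f\|_{L^2}$ (equivalently, on the Fourier side, the weighted $L^2$ space with norm $\||\xi|\hat f\|_{L^2}$), and let $\mathcal W(t)$ be the solution map of the free wave equation on $\dot H^1(\mathbb R^d)\times L^2(\mathbb R^d)$, that is $$\mathcal W(t)(f,g)=\bigl(\cos(t|\nabla|)f+|\nabla|^{-1}\sin(t|\nabla|)g,\ -|\nabla|\sin(t|\nabla|)f+\cos(t|\nabla|)g\bigr).$$ Then there is a constant $C>0$, depending only on $d,\mu_1,\mu_2$, such that the following holds. Let $(u_{l,0},u_{l,1})\in H^1(\mathbb R^d)\times L^2(\mathbb R^d)$ and let $u_l\in C([0,\infty);H^1(\mathbb R^d))\cap C^1([0,\infty);L^2(\mathbb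 R^d))$ be the solution, in the sense of distributions, of $$\partial_t^2u_l-\Delta u_l+\frac{\mu_1}{1+t}\,\partial_tu_l+\frac{\mu_2}{(1+t)^2}\,u_l=0\ \text{ on }(0,\infty)\times\mathbb R^d,\qquad (u_l(0),\partial_tu_l(0))=(u_{l,0},u_{l,1}).$$ Then there exists $\vec v_+\in\dot H^1(\mathbb R^d)\times L^2(\mathbb R^d)$ such that for all $t\ge 0$ $$\bigl\|u_l(t)-(1+t)^{-\frac{\mu_1}2}(\mathcal W(t)\vec v_+)_1\bigr\|_{\dot H^1}\le C\,\mu\,\bigl(\|u_{l,0}\|_{L^2}+\|u_{l,1}\|_{L^2}\bigr)\,r(t)$$ and $$\bigl\|\partial_tu_l(t)-(1+t)^{-\frac{\mu_1}2}(\mathcal W(t)\vec v_+)_2\bigr\|_{L^2}\le C\,(\mu+|\mu_1|)\,\bigl(\|u_{l,0}\|_{L^2}+\|u_{l,1}\|_{L^2}\bigr)\,r(t),$$ where $(\cdot)_j$ denotes the $j$-th component and $$r(t)=\begin{cases}(1+t)^{-\frac12+\mathrm{Re}\,\nu-\frac{\mu_1}2},&\mu\ne\frac14,\\[2pt](1+t)^{-\frac12-\frac{\mu_1}2}\,(1+\log(1+t)),&\mu=\frac14.\end{cases}$$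 -/

import Mathlib

open MeasureTheory Set
open scoped FourierTransform SchwartzMap Laplacian ENNReal

noncomputable section

namespace DampedWave

/-- The Euclidean space `ℝ^d`. -/
abbrev Space (d : ℕ) : Type := EuclideanSpace ℝ (Fin d)

/-- `L²(ℝ^d)`, complex valued. -/
abbrev L2 (d : ℕ) : Type := Lp ℂ 2 (volume : Measure (Space d))

/-- The symbol of `|∇| = (-Δ)^{1/2}`.  With the normalisation `𝓕 f ξ = ∫ exp (-2πi ⟨x, ξ⟩) f x dx`
of the Fourier transform, `-Δ` has the symbol `(2π|ξ|)²`. -/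
def absGrad {d : ℕ} (ξ : Space d) : ℝ := 2 * Real.pi * ‖ξ‖

/-- The measure `(2π|ξ|)² dξ` on frequency space. -/
def gradMeasure (d : ℕ) : Measure (Space d) :=
  volume.withDensity fun ξ => ENNReal.ofReal (absGrad ξ ^ 2)

/-- The homogeneous Sobolev space `Ḣ¹(ℝ^d)`, i.e. the completion of the Schwartz space for the norm
`‖∇f‖_{L²} = ‖ |∇| f ‖_{L²}`.  By Plancherel's theorem, the Fourier transform identifies it with the
weighted space `L²((2π|ξ|)² dξ)`; an element of `HDot1 d` is the Fourier transform of an element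
of `Ḣ¹`, and its norm is the `Ḣ¹` norm. -/
abbrev HDot1 (d : ℕ) : Type := Lp ℂ 2 (gradMeasure d)

lemma gradMeasure_ac (d : ℕ) : gradMeasure d ≪ (volume : Measure (Space d)) :=
  withDensity_absolutelyContinuous _ _

lemma continuous_absGrad {d : ℕ} : Continuous (absGrad : Space d → ℝ) := by
  unfold absGrad; fun_prop

lemma memLp_gradMeasure_iff {d : ℕ} {F : Space d → ℂ} (hF : AEStronglyMeasurable F volume) :
    MemLp F 2 (gradMeasure d) ↔ MemLp (fun ξ => (absGrad ξ : ℂ) * F ξ) 2 volume := by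
  have hm : AEStronglyMeasurable (fun ξ => (absGrad ξ : ℂ) * F ξ) volume :=
    (Complex.continuous_ofReal.comp continuous_absGrad).aestronglyMeasurable.mul hF
  rw [memLp_two_iff_integrable_sq_norm (hF.mono_ac (gradMeasure_ac d)),
    memLp_two_iff_integrable_sq_norm hm, gradMeasure,
    integrable_withDensity_iff (continuous_absGrad.measurable.pow_const 2).ennreal_ofReal
      (Filter.Eventually.of_forall fun _ => ENNReal.ofReal_lt_top)]
  refine integrable_congr (Filter.Eventually.of_forall fun ξ => ?_)
  simp only [norm_mul, Complex.norm_real, Real.norm_eq_abs]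
  rw [ENNReal.toReal_ofReal (sq_nonneg _), mul_pow, sq_abs, mul_comm]

/-- `H¹(ℝ^d)`, as the space of all `f ∈ L²` with `∫ (2π|ξ|)² |𝓕 f ξ|² dξ < ∞`. -/
def H1 (d : ℕ) : Submodule ℂ (L2 d) where
  carrier := {f | MemLp (𝓕 f : L2 d) 2 (gradMeasure d)}
  zero_mem' := by
    have h : (𝓕 (0 : L2 d) : L2 d) = 0 := (Lp.fourierTransformₗᵢ (Space d) ℂ).map_zero
    simp only [mem_ofPred_eq, h]
    exact (memLp_congr_ae ((gradMeasure_ac d).ae_le (Lp.coeFn_zero ℂ 2 volume))).2 MemLp.zero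
  add_mem' := by
    intro f g hf hg
    have h : (𝓕 (f + g) : L2 d) = 𝓕 f + 𝓕 g := (Lp.fourierTransformₗᵢ (Space d) ℂ).map_add f g
    simp only [mem_ofPred_eq, h] at hf hg ⊢
    exact (memLp_congr_ae ((gradMeasure_ac d).ae_le (Lp.coeFn_add _ _))).2 (hf.add hg)
  smul_mem' := by
    intro c f hf
    have h : (𝓕 (c • f) : L2 d) = c • 𝓕 f := (Lp.fourierTransformₗᵢ (Space d) ℂ).map_smul c f
    simp only [mem_ofPred_eq, h] at hf ⊢
    exact (memLp_congr_ae ((gradMeasure_ac d).ae_le (Lp.coeFn_smul _ _))).2 (hf.const_smul c)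

/-- The canonical map `H¹ → Ḣ¹`. -/
def toHDot1 {d : ℕ} (f : H1 d) : HDot1 d := MemLp.toLp (𝓕 (f : L2 d) : L2 d) f.2

lemma memLp_bounded_mul {d : ℕ} {m : Measure (Space d)} {a : Space d → ℝ} (ha : Measurable a)
    (hb : ∀ ξ, |a ξ| ≤ 1) {F : Space d → ℂ} (hF : MemLp F 2 m) :
    MemLp (fun ξ => (a ξ : ℂ) * F ξ) 2 m := by
  refine hF.of_le ((Complex.measurable_ofReal.comp ha).aestronglyMeasurable.mul hF.1)
    (Filter.Eventually.of_forall fun ξ => ?_)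
  simp only [norm_mul, Complex.norm_real, Real.norm_eq_abs]
  exact mul_le_of_le_one_left (norm_nonneg _) (hb ξ)

lemma memLp_W0 {d : ℕ} (t : ℝ) (F : HDot1 d) :
    MemLp (fun ξ => (Real.cos (t * absGrad ξ) : ℂ) * F ξ) 2 (gradMeasure d) :=
  memLp_bounded_mul (Real.continuous_cos.comp (continuous_absGrad.const_mul t)).measurable
    (fun _ => Real.abs_cos_le_one _) (Lp.memLp F)

lemma memLp_W1 {d : ℕ} (t : ℝ) (g : L2 d) :
    MemLp (fun ξ => ((Real.sin (t * absGrad ξ) / absGrad ξ : ℝ) : ℂ) * (𝓕 g : L2 d) ξ) 2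
      (gradMeasure d) := by
  have hs : Measurable fun ξ : Space d => Real.sin (t * absGrad ξ) :=
    (Real.continuous_sin.comp (continuous_absGrad.const_mul t)).measurable
  have hq : Measurable fun ξ : Space d => Real.sin (t * absGrad ξ) / absGrad ξ :=
    hs.div continuous_absGrad.measurable
  refine (memLp_gradMeasure_iff ?_).2 ?_
  · exact (Complex.measurable_ofReal.comp hq).aestronglyMeasurable.mul
      (Lp.memLp (𝓕 g : L2 d)).1
  · refine (congrArg (MemLp · 2 volume) (funext fun ξ => ?_)).mp
      (memLp_bounded_mul hs (fun _ => Real.abs_sin_le_one _) (Lp.memLp (𝓕 g : L2 d)))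
    by_cases h : absGrad ξ = 0
    · simp [h]
    · rw [← mul_assoc, ← Complex.ofReal_mul, mul_div_cancel₀ _ h]

lemma memLp_dW0 {d : ℕ} (t : ℝ) (F : HDot1 d) :
    MemLp (fun ξ => ((-(absGrad ξ * Real.sin (t * absGrad ξ)) : ℝ) : ℂ) * F ξ) 2 volume := by
  have hs : Measurable fun ξ : Space d => -Real.sin (t * absGrad ξ) :=
    (Real.continuous_sin.comp (continuous_absGrad.const_mul t)).measurable.neg
  refine (congrArg (MemLp · 2 volume) (funext fun ξ => ?_)).mp
    (memLp_bounded_mul hs (fun _ => by rw [abs_neg]; exact Real.abs_sin_le_one _)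
      ((memLp_gradMeasure_iff (Lp.stronglyMeasurable F).aestronglyMeasurable).1 (Lp.memLp F)))
  push_cast
  ring

lemma memLp_dW1 {d : ℕ} (t : ℝ) (g : L2 d) :
    MemLp (fun ξ => (Real.cos (t * absGrad ξ) : ℂ) * (𝓕 g : L2 d) ξ) 2 volume :=
  memLp_bounded_mul (Real.continuous_cos.comp (continuous_absGrad.const_mul t)).measurable
    (fun _ => Real.abs_cos_le_one _) (Lp.memLp _)

/-- `𝓦₀(t) = cos (t|∇|)`, on `Ḣ¹`. -/
def W0 {d : ℕ} (t : ℝ) (F : HDot1 d) : HDot1 d := (memLp_W0 t F).toLp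

/-- `𝓦₁(t) = |∇|⁻¹ sin (t|∇|)`, from `L²` to `Ḣ¹`. -/
def W1 {d : ℕ} (t : ℝ) (g : L2 d) : HDot1 d := (memLp_W1 t g).toLp

/-- The time derivative `-|∇| sin (t|∇|)` of `𝓦₀(t)`, from `Ḣ¹` to `L²`. -/
def dW0 {d : ℕ} (t : ℝ) (F : HDot1 d) : L2 d := 𝓕⁻ ((memLp_dW0 t F).toLp : L2 d)

/-- The time derivative `cos (t|∇|)` of `𝓦₁(t)`, on `L²`. -/
def dW1 {d : ℕ} (t : ℝ) (g : L2 d) : L2 d := 𝓕⁻ ((memLp_dW1 t g).toLp : L2 d)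

/-- The solution map `𝓦(t)` of the free wave equation on `Ḣ¹ × L²`: it maps the data `(w, ∂ₜw)` at
time `0` to `(w, ∂ₜw)` at time `t`. -/
def W {d : ℕ} (t : ℝ) (v : HDot1 d × L2 d) : HDot1 d × L2 d :=
  (W0 t v.1 + W1 t v.2, dW0 t v.1 + dW1 t v.2)

/-- `u`, with time derivative `u'`, is the solution on `[0, ∞) × ℝ^d` of
`∂ₜ²u - Δu + μ₁/(1+t) ∂ₜu + μ₂/(1+t)² u = 0`, `(u(0), ∂ₜu(0)) = (u₀, u₁)`: it lies in the energy class
`C([0,∞); H¹) ∩ C¹([0,∞); L²)`, and the equation holds in the sense of distributions. Only the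
values at times `t ≥ 0` matter. -/
structure IsSolution {d : ℕ} (μ₁ μ₂ : ℝ) (u₀ : H1 d) (u₁ : L2 d) (u : ℝ → H1 d) (u' : ℝ → L2 d) :
    Prop where
  continuousOn_L2 : ContinuousOn (fun t => (u t : L2 d)) (Ici 0)
  continuousOn_HDot1 : ContinuousOn (fun t => toHDot1 (u t)) (Ici 0)
  hasDeriv : ∀ t, 0 ≤ t → HasDerivWithinAt (fun s => (u s : L2 d)) (u' t) (Ici 0) t
  continuousOn_deriv : ContinuousOn u' (Ici 0)
  initial : u 0 = u₀
  initial_deriv : u' 0 = u₁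
  equation : ∀ φ : 𝓢(Space d, ℂ), ∀ t, 0 < t →
    HasDerivAt (fun s => (u' s : 𝓢'(Space d, ℂ)) φ)
      ((Δ ((u t : L2 d) : 𝓢'(Space d, ℂ))) φ
        - ((μ₁ / (1 + t) : ℝ) : ℂ) * (u' t : 𝓢'(Space d, ℂ)) φ
        - ((μ₂ / (1 + t) ^ 2 : ℝ) : ℂ) * ((u t : L2 d) : 𝓢'(Space d, ℂ)) φ) t

/-- `μ = μ₁ (2 - μ₁) / 4 + μ₂`. -/
def mass (μ₁ μ₂ : ℝ) : ℝ := μ₁ * (2 - μ₁) / 4 + μ₂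

/-- `ν = √(1 - 4μ) / 2` if `μ ≤ 1/4`, and `ν = i √(4μ - 1) / 2` if `μ > 1/4`. -/
def nu (μ : ℝ) : ℂ :=
  if μ ≤ 1 / 4 then 1 / 2 * (√(1 - 4 * μ) : ℂ) else Complex.I / 2 * (√(4 * μ - 1) : ℂ)

/-- The rate `(1+t)^{-1/2 + Re ν - μ₁/2}` if `μ ≠ 1/4`, and `(1+t)^{-1/2 - μ₁/2} (1 + log (1+t))` if
`μ = 1/4`. -/
def rate (μ μ₁ t : ℝ) : ℝ :=
  if μ = 1 / 4 then (1 + t) ^ (-(1 / 2) - μ₁ / 2) * (1 + Real.log (1 + t))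
  else (1 + t) ^ (-(1 / 2) + (nu μ).re - μ₁ / 2)

end DampedWave

end

/-! The Liouville transform w = (1+t)^{μ₁/2} u removes the damping and leaves ∂ₜ²w + |∇|²w +
μ(1+t)⁻²w = 0. The potential is a perturbation of the free wave equation: the half-waves
e^{±it|∇|}(∂ₜw ∓ i|∇|w), constant for free waves, have derivative -e^{±it|∇|} μ(1+t)⁻² w. If ‖w(t)‖
≤ K g(t) in L², with g = `growth μ`, they converge at the rate Kμ∫_t^∞ g(τ)(1+τ)⁻² dτ, which is O(Kμ
g(t)/(1+t)) when μ > 0 and zero when μ = 0. The two limits determine the free wave, and undoing the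
transform gives `rate`. The formula for ∂ₜu contains one more term, μ₁w/(1+t), which is the source
of |μ₁| in the second estimate.

The core is the L² growth bound. At frequency |∇| ~ ρ the potential dominates while (1+t)ρ ≤ 1, and
the oscillation afterwards. In the first regime the solution y is compared with a positive solution
h of h'' + μ(1+t)⁻²h = 0 by a Gronwall argument for y/h and the Wronskian hy' - h'y
(`growth_of_solution`). For μ > 1/4 scalar solutions oscillate; then h = √(1+t), the solution for μ
= 1/4, is used, and the excess κ² = μ - 1/4 only rotates the pair (`growth_sqrt`). In the second
regime the energy decreases, and from time 1/ρ - 1 on it bounds y (`norm_le_of_energy`). The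
constants do not depend on ρ (`exists_growth_bound`), so the bounds on dyadic shells add up in L²
(`IsSpectralSolution.norm_le`).

The ODE arguments are made for Hilbert space valued oscillators with a bounded symmetric operator M.
They apply to a whole frequency band at once, where |∇| is bounded and the equation holds in the
norm of L², so no solution at an individual frequency is needed. -/

noncomputable section

namespace DampedWave

/-! ### Abstract oscillators: energy and growth relative to scalar solutions -/

/-- `y` with derivative `p` solves `y'' + μ/(1+t)² y + M² y = 0` on `[0, ∞)`, where `M` is a bounded
symmetric operator. -/
structure IsOscillator {H : Type*} [NormedAddCommGroup H] [InnerProductSpace ℝ H] (μ : ℝ)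
    (M : H →L[ℝ] H) (y p : ℝ → H) : Prop where
  symm : ∀ x z, inner ℝ (M x) z = inner ℝ x (M z)
  cont : ContinuousOn y (Ici 0)
  cont_deriv : ContinuousOn p (Ici 0)
  deriv : ∀ t, 0 < t → HasDerivAt y (p t) t
  deriv2 : ∀ t, 0 < t → HasDerivAt p (-((μ / (1 + t) ^ 2) • y t) - M (M (y t))) t

namespace IsOscillator

variable {H : Type*} [NormedAddCommGroup H] [InnerProductSpace ℝ H] {μ : ℝ} {M : H →L[ℝ] H}
  {y p : ℝ → H}

/-- The energy of an oscillator does not increase. -/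
lemma antitoneOn_energy (h : IsOscillator μ M y p) (hμ : 0 ≤ μ) :
    AntitoneOn (fun t => ‖p t‖ ^ 2 + ‖M (y t)‖ ^ 2 + μ / (1 + t) ^ 2 * ‖y t‖ ^ 2) (Ici 0) := by
  have hd : ∀ t, 0 < t → HasDerivAt
      (fun t => ‖p t‖ ^ 2 + ‖M (y t)‖ ^ 2 + μ / (1 + t) ^ 2 * ‖y t‖ ^ 2)
      (-(2 * μ / (1 + t) ^ 3 * ‖y t‖ ^ 2)) t := by
    intro t ht
    have h1 := (h.deriv2 t ht).norm_sq
    have h2 := (M.hasFDerivAt.comp_hasDerivAt t (h.deriv t ht)).norm_sq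
    have h3 := (h.deriv t ht).norm_sq
    have h4 : HasDerivAt (fun t : ℝ => μ / (1 + t) ^ 2) (-(2 * μ / (1 + t) ^ 3)) t := by
      have ht1 : (1 + t) ^ 2 ≠ 0 := by positivity
      refine ((hasDerivAt_const t μ).div (((hasDerivAt_id t).const_add 1).pow 2)
        ht1).congr_deriv ?_
      have : (1 + t) ≠ 0 := by positivity
      simp
      field_simp
    -- By the symmetry of M the cross terms cancel; only the derivative of the decreasing
    -- coefficient μ/(1+t)² survives.
    refine ((h1.add h2).add (h4.mul h3)).congr_deriv ?_
    simp only [Function.comp_apply, inner_sub_right, inner_neg_right, inner_smul_right,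
      real_inner_comm (p t) (y t), h.symm (y t)]
    rw [real_inner_comm (M (M (y t))) (p t), h.symm, h.symm, real_inner_comm (M (M (p t)))]
    ring
  refine antitoneOn_of_deriv_nonpos (convex_Ici 0) ?_ ?_ ?_
  · have hc : ContinuousOn (fun t : ℝ => μ / (1 + t) ^ 2) (Ici 0) :=
      ContinuousOn.div (by fun_prop) (by fun_prop) fun t ht => by
        have : 0 ≤ t := ht
        positivity
    have := h.cont
    have := h.cont_deriv
    fun_prop
  · intro t ht
    rw [interior_Ici] at ht
    exact (hd t ht).differentiableAt.differentiableWithinAt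
  · intro t ht
    rw [interior_Ici] at ht
    rw [(hd t ht).deriv]
    have : 0 < t := ht
    have : 0 ≤ 2 * μ / (1 + t) ^ 3 * ‖y t‖ ^ 2 := by positivity
    linarith

/-- Where `M ≥ ρ/2`, the energy controls the solution at later times. -/
lemma norm_le_of_energy (h : IsOscillator μ M y p) (hμ : 0 ≤ μ) {ρ : ℝ} (hρ : 0 < ρ)
    (hM : ∀ x, ‖M x‖ ≤ ρ * ‖x‖) (hy : ∀ t, ρ / 2 * ‖y t‖ ≤ ‖M (y t)‖) {T t : ℝ} (hT : 0 ≤ T)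
    (hTt : T ≤ t) :
    ‖y t‖ ≤ 2 / ρ * (‖p T‖ + ρ * ‖y T‖ + √μ / (1 + T) * ‖y T‖) := by
  have hE := h.antitoneOn_energy hμ (mem_Ici.2 hT) (mem_Ici.2 (hT.trans hTt)) hTt
  simp only at hE
  have h1 : 0 ≤ μ / (1 + t) ^ 2 * ‖y t‖ ^ 2 := by positivity
  have h2 : ‖M (y T)‖ ^ 2 ≤ (ρ * ‖y T‖) ^ 2 := pow_le_pow_left₀ (norm_nonneg _) (hM _) 2
  have h3 : μ / (1 + T) ^ 2 * ‖y T‖ ^ 2 = (√μ / (1 + T) * ‖y T‖) ^ 2 := by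
    rw [mul_pow, div_pow, Real.sq_sqrt hμ]
  set a := ‖p T‖
  set b := ρ * ‖y T‖
  set c := √μ / (1 + T) * ‖y T‖
  have ha : 0 ≤ a := norm_nonneg _
  have hb : 0 ≤ b := by positivity
  have hc : 0 ≤ c := by positivity
  have h4 : ‖M (y t)‖ ≤ a + b + c := by
    refine le_of_sq_le_sq ?_ (by positivity)
    nlinarith [mul_nonneg ha hb, mul_nonneg ha hc, mul_nonneg hb hc, sq_nonneg ‖p t‖]
  rw [div_mul_eq_mul_div, le_div_iff₀ hρ]
  nlinarith [hy t]

/-- Growth of an oscillator at low frequency, relative to a positive solution `h` of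
`h'' + μ/(1+t)² h = 0`. -/
lemma growth_of_solution (ho : IsOscillator μ M y p) {ρ : ℝ} (hρ : 0 ≤ ρ)
    (hM : ∀ x, ‖M x‖ ≤ ρ * ‖x‖) {h h' K : ℝ → ℝ}
    (hpos : ∀ t, 0 ≤ t → 0 < h t) (hpos' : ∀ t, 0 ≤ t → 0 ≤ h' t)
    (hd : ∀ t, 0 ≤ t → HasDerivAt h (h' t) t)
    (hd' : ∀ t, 0 ≤ t → HasDerivAt h' (-(μ / (1 + t) ^ 2) * h t) t)
    (hK : ∀ t, 0 ≤ t → HasDerivAt K (1 / h t ^ 2) t) :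
    AntitoneOn (fun t => (‖(h t)⁻¹ • y t‖ ^ 2
      + ‖h t • p t - h' t • y t‖ ^ 2 / (1 + ρ * h t ^ 2) ^ 2) * Real.exp (-(K t + 2 * ρ * t)))
      (Ici 0) := by
  have hyc := ho.cont
  have hpc := ho.cont_deriv
  have hhc : ContinuousOn h (Ici 0) := fun t ht => (hd t ht).continuousAt.continuousWithinAt
  have hhc' : ContinuousOn h' (Ici 0) := fun t ht => (hd' t ht).continuousAt.continuousWithinAt
  have hKc : ContinuousOn K (Ici 0) := fun t ht => (hK t ht).continuousAt.continuousWithinAt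
  -- With ζ = y/h and η = hp - h'y, the scalar equation for h removes μ: ζ' = η/h² and η' = -h²M²ζ.
  -- The weight σ = 1 + ρh² on η balances the coupling coefficients h⁻² and ρ²h².
  have hder : ∀ t, 0 < t → ∃ D ≤ 0, HasDerivAt (fun t => (‖(h t)⁻¹ • y t‖ ^ 2
      + ‖h t • p t - h' t • y t‖ ^ 2 / (1 + ρ * h t ^ 2) ^ 2) * Real.exp (-(K t + 2 * ρ * t)))
      D t := by
    intro t ht
    have ht0 := ht.le
    have hp := hpos t ht0
    have hζ : HasDerivAt (fun t => (h t)⁻¹ • y t)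
        ((h t ^ 2)⁻¹ • (h t • p t - h' t • y t)) t := by
      refine (((hd t ht0).inv hp.ne').smul (ho.deriv t ht)).congr_deriv ?_
      simp only [Pi.inv_apply]
      rw [smul_sub, smul_smul, smul_smul, sub_eq_add_neg, ← neg_smul]
      congr 2 <;> field_simp
    have hη : HasDerivAt (fun t => h t • p t - h' t • y t) (-(h t • M (M (y t)))) t := by
      refine (((hd t ht0).smul (ho.deriv2 t ht)).sub
        ((hd' t ht0).smul (ho.deriv t ht))).congr_deriv ?_
      rw [smul_sub, smul_neg, smul_smul, neg_mul, neg_smul, mul_comm (h t)]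
      abel
    have hσ : HasDerivAt (fun t => (1 + ρ * h t ^ 2) ^ 2)
        (2 * (1 + ρ * h t ^ 2) * (ρ * (2 * h t * h' t))) t := by
      refine (((((hd t ht0).pow 2).const_mul ρ).const_add 1).pow 2).congr_deriv ?_
      simp
    have hσ0 : 0 < 1 + ρ * h t ^ 2 := by positivity
    have hexp : HasDerivAt (fun t => Real.exp (-(K t + 2 * ρ * t)))
        (Real.exp (-(K t + 2 * ρ * t)) * -(1 / h t ^ 2 + 2 * ρ)) t := by
      refine ((hK t ht0).add ((hasDerivAt_id t).const_mul (2 * ρ))).neg.exp.congr_deriv ?_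
      simp
    refine ⟨_, ?_, (hζ.norm_sq.add (hη.norm_sq.div hσ (by positivity))).mul hexp⟩
    have hζy : ‖M (M (y t))‖ ≤ ρ ^ 2 * (h t * ‖(h t)⁻¹ • y t‖) := by
      rw [norm_smul, norm_inv, Real.norm_of_nonneg hp.le, mul_inv_cancel_left₀ hp.ne', sq, mul_assoc]
      exact (hM _).trans (mul_le_mul_of_nonneg_left (hM _) hρ)
    set ζ := (h t)⁻¹ • y t
    set η := h t • p t - h' t • y t
    set σ := 1 + ρ * h t ^ 2 with hσdef
    have e1 : inner ℝ ζ ((h t ^ 2)⁻¹ • η) ≤ (h t ^ 2)⁻¹ * (‖ζ‖ * ‖η‖) := by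
      rw [inner_smul_right]
      exact mul_le_mul_of_nonneg_left (real_inner_le_norm _ _) (by positivity)
    have e2 : inner ℝ η (-(h t • M (M (y t)))) ≤ ρ ^ 2 * h t ^ 2 * (‖ζ‖ * ‖η‖) := by
      refine (real_inner_le_norm _ _).trans ?_
      rw [norm_neg, norm_smul, Real.norm_of_nonneg hp.le]
      calc ‖η‖ * (h t * ‖M (M (y t))‖) ≤ ‖η‖ * (h t * (ρ ^ 2 * (h t * ‖ζ‖))) := by gcongr
        _ = _ := by ring
    -- As h' ≥ 0, differentiating the weight only helps.
    have e3 : 0 ≤ ‖η‖ ^ 2 * (2 * σ * (ρ * (2 * h t * h' t))) := by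
      have := hpos' t ht0
      positivity
    have key : 2 * inner ℝ ζ ((h t ^ 2)⁻¹ • η)
        + (2 * inner ℝ η (-(h t • M (M (y t)))) * σ ^ 2
          - ‖η‖ ^ 2 * (2 * σ * (ρ * (2 * h t * h' t)))) / (σ ^ 2) ^ 2
        ≤ (‖ζ‖ ^ 2 + ‖η‖ ^ 2 / σ ^ 2) * (1 / h t ^ 2 + 2 * ρ) := by
      have s1 : (2 * inner ℝ η (-(h t • M (M (y t)))) * σ ^ 2
          - ‖η‖ ^ 2 * (2 * σ * (ρ * (2 * h t * h' t)))) / (σ ^ 2) ^ 2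
          ≤ 2 * (ρ ^ 2 * h t ^ 2 * (‖ζ‖ * ‖η‖)) / σ ^ 2 := by
        rw [div_le_div_iff₀ (by positivity) (by positivity)]
        have : (2 * inner ℝ η (-(h t • M (M (y t)))) * σ ^ 2
          - ‖η‖ ^ 2 * (2 * σ * (ρ * (2 * h t * h' t)))) ≤
            2 * (ρ ^ 2 * h t ^ 2 * (‖ζ‖ * ‖η‖)) * σ ^ 2 := by
          nlinarith [mul_le_mul_of_nonneg_right e2 (sq_nonneg σ)]
        calc _ ≤ 2 * (ρ ^ 2 * h t ^ 2 * (‖ζ‖ * ‖η‖)) * σ ^ 2 * σ ^ 2 := by gcongr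
          _ = _ := by ring
      have s2 : 2 * (‖ζ‖ * ‖η‖) ≤ (‖ζ‖ ^ 2 + ‖η‖ ^ 2 / σ ^ 2) * σ := by
        have := mul_nonneg hσ0.le (sq_nonneg (‖ζ‖ - ‖η‖ / σ))
        have e : σ * (‖ζ‖ - ‖η‖ / σ) ^ 2
            = (‖ζ‖ ^ 2 + ‖η‖ ^ 2 / σ ^ 2) * σ - 2 * (‖ζ‖ * ‖η‖) := by
          field_simp
          ring
        linarith
      -- After rescaling η by σ the couplings are σ/h² = 1/h² + ρ and ρ²h²/σ ≤ ρ. Their sum is the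
      -- derivative of K + 2ρt, the exponent chosen.
      have s3 : σ * ((h t ^ 2)⁻¹ + ρ ^ 2 * h t ^ 2 / σ ^ 2) ≤ 1 / h t ^ 2 + 2 * ρ := by
        have : ρ ^ 2 * h t ^ 2 / σ ≤ ρ := by
          rw [div_le_iff₀ hσ0, hσdef]
          nlinarith
        have e : σ * ((h t ^ 2)⁻¹ + ρ ^ 2 * h t ^ 2 / σ ^ 2)
            = 1 / h t ^ 2 + ρ + ρ ^ 2 * h t ^ 2 / σ := by
          have : σ * (h t ^ 2)⁻¹ = 1 / h t ^ 2 + ρ := by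
            rw [hσdef]; field_simp
          rw [mul_add, this]
          field_simp
        linarith
      calc _ ≤ 2 * ((h t ^ 2)⁻¹ * (‖ζ‖ * ‖η‖)) + 2 * (ρ ^ 2 * h t ^ 2 * (‖ζ‖ * ‖η‖)) / σ ^ 2 := by
            linarith
        _ = 2 * (‖ζ‖ * ‖η‖) * ((h t ^ 2)⁻¹ + ρ ^ 2 * h t ^ 2 / σ ^ 2) := by ring
        _ ≤ (‖ζ‖ ^ 2 + ‖η‖ ^ 2 / σ ^ 2) * σ * ((h t ^ 2)⁻¹ + ρ ^ 2 * h t ^ 2 / σ ^ 2) := by gcongr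
        _ = (‖ζ‖ ^ 2 + ‖η‖ ^ 2 / σ ^ 2) * (σ * ((h t ^ 2)⁻¹ + ρ ^ 2 * h t ^ 2 / σ ^ 2)) := by ring
        _ ≤ _ := by gcongr
    have := mul_le_mul_of_nonneg_right key (Real.exp_pos (-(K t + 2 * ρ * t))).le
    simp only [Pi.add_apply, Pi.div_apply]
    linarith
  refine antitoneOn_of_deriv_nonpos (convex_Ici 0) ?_ ?_ ?_
  · refine ContinuousOn.mul (ContinuousOn.add ?_ (ContinuousOn.div ?_ ?_ ?_)) (by fun_prop)
    · exact ((hhc.inv₀ fun t ht => (hpos t ht).ne').smul hyc).norm.pow 2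
    · fun_prop
    · fun_prop
    · intro t ht
      have := hpos t ht
      positivity
  · intro t ht
    rw [interior_Ici] at ht
    obtain ⟨D, -, hD⟩ := hder t ht
    exact hD.differentiableAt.differentiableWithinAt
  · intro t ht
    rw [interior_Ici] at ht
    obtain ⟨D, hD0, hD⟩ := hder t ht
    rwa [hD.deriv]

/-- Growth of an oscillator at low frequency, relative to `h = √(1+t)`, for
`μ = 1/4 + κ²` with `κ > 0`. -/
lemma growth_sqrt {κ : ℝ} (ho : IsOscillator (1 / 4 + κ ^ 2) M y p) (hκ : 0 < κ) {ρ : ℝ}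
    (hρ : 0 ≤ ρ) (hM : ∀ x, ‖M x‖ ≤ ρ * ‖x‖) {h h' : ℝ → ℝ}
    (hpos : ∀ t, 0 ≤ t → 0 < h t) (hsq : ∀ t, 0 ≤ t → h t ^ 2 = 1 + t)
    (hd : ∀ t, 0 ≤ t → HasDerivAt h (h' t) t)
    (hd' : ∀ t, 0 ≤ t → HasDerivAt h' (-(1 / 4 / (1 + t) ^ 2) * h t) t) :
    AntitoneOn (fun t => (κ ^ 2 * ‖(h t)⁻¹ • y t‖ ^ 2
      + ‖h t • p t - h' t • y t‖ ^ 2) * Real.exp (-(ρ ^ 2 * (1 + t) ^ 2 / (2 * κ))))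
      (Ici 0) := by
  have hyc := ho.cont
  have hpc := ho.cont_deriv
  have hhc : ContinuousOn h (Ici 0) := fun t ht => (hd t ht).continuousAt.continuousWithinAt
  have hhc' : ContinuousOn h' (Ici 0) := fun t ht => (hd' t ht).continuousAt.continuousWithinAt
  -- Here h² = 1+t and h solves the equation for 1/4 only, so the excess κ² remains: ζ' = η/(1+t),
  -- η' = -hM²y - κ²ζ/(1+t).
  have hder : ∀ t, 0 < t → ∃ D ≤ 0, HasDerivAt (fun t => (κ ^ 2 * ‖(h t)⁻¹ • y t‖ ^ 2
      + ‖h t • p t - h' t • y t‖ ^ 2) * Real.exp (-(ρ ^ 2 * (1 + t) ^ 2 / (2 * κ)))) D t := by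
    intro t ht
    have ht0 := ht.le
    have hp := hpos t ht0
    have hs := hsq t ht0
    have hζ : HasDerivAt (fun t => (h t)⁻¹ • y t)
        ((1 + t)⁻¹ • (h t • p t - h' t • y t)) t := by
      refine (((hd t ht0).inv hp.ne').smul (ho.deriv t ht)).congr_deriv ?_
      simp only [Pi.inv_apply]
      rw [smul_sub, smul_smul, smul_smul, sub_eq_add_neg, ← neg_smul, ← hs]
      congr 2 <;> field_simp
    have hη : HasDerivAt (fun t => h t • p t - h' t • y t)
        (-(h t • M (M (y t))) - (κ ^ 2 / (1 + t)) • ((h t)⁻¹ • y t)) t := by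
      refine (((hd t ht0).smul (ho.deriv2 t ht)).sub
        ((hd' t ht0).smul (ho.deriv t ht))).congr_deriv ?_
      have e : κ ^ 2 / (1 + t) * (h t)⁻¹ = κ ^ 2 / (1 + t) ^ 2 * h t := by
        rw [← hs]; field_simp
      rw [smul_smul, e]
      simp only [smul_sub, smul_neg, smul_smul, neg_mul, neg_smul]
      have e' : h t * ((1 / 4 + κ ^ 2) / (1 + t) ^ 2)
          = κ ^ 2 / (1 + t) ^ 2 * h t + 1 / 4 / (1 + t) ^ 2 * h t := by ring
      rw [e', add_smul]
      abel
    have hexp : HasDerivAt (fun t => Real.exp (-(ρ ^ 2 * (1 + t) ^ 2 / (2 * κ))))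
        (Real.exp (-(ρ ^ 2 * (1 + t) ^ 2 / (2 * κ))) * -(ρ ^ 2 * (1 + t) / κ)) t := by
      refine (((((hasDerivAt_id t).const_add 1).pow 2).const_mul (ρ ^ 2)).div_const
        (2 * κ)).neg.exp.congr_deriv ?_
      simp
      field_simp
    refine ⟨_, ?_, ((hζ.norm_sq.const_mul (κ ^ 2)).add hη.norm_sq).mul hexp⟩
    have hζy : ‖M (M (y t))‖ ≤ ρ ^ 2 * (h t * ‖(h t)⁻¹ • y t‖) := by
      rw [norm_smul, norm_inv, Real.norm_of_nonneg hp.le, mul_inv_cancel_left₀ hp.ne', sq, mul_assoc]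
      exact (hM _).trans (mul_le_mul_of_nonneg_left (hM _) hρ)
    set ζ := (h t)⁻¹ • y t
    set η := h t • p t - h' t • y t
    have e2 : inner ℝ η (-(h t • M (M (y t)))) ≤ ρ ^ 2 * (1 + t) * (‖ζ‖ * ‖η‖) := by
      refine (real_inner_le_norm _ _).trans ?_
      rw [norm_neg, norm_smul, Real.norm_of_nonneg hp.le, ← hs]
      calc ‖η‖ * (h t * ‖M (M (y t))‖) ≤ ‖η‖ * (h t * (ρ ^ 2 * (h t * ‖ζ‖))) := by gcongr
        _ = _ := by ring
    -- The κ² coupling is a rotation for the quadratic form κ²‖ζ‖² + ‖η‖², hence drops out. What is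
    -- left is of size ρ²(1+t)/κ, the derivative of ρ²(1+t)²/(2κ).
    have key : κ ^ 2 * (2 * inner ℝ ζ ((1 + t)⁻¹ • η))
        + 2 * inner ℝ η (-(h t • M (M (y t))) - (κ ^ 2 / (1 + t)) • ζ)
        ≤ (κ ^ 2 * ‖ζ‖ ^ 2 + ‖η‖ ^ 2) * (ρ ^ 2 * (1 + t) / κ) := by
      rw [inner_sub_right, inner_smul_right, inner_smul_right, real_inner_comm η ζ]
      have s2 : 2 * (‖ζ‖ * ‖η‖) ≤ (κ ^ 2 * ‖ζ‖ ^ 2 + ‖η‖ ^ 2) / κ := by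
        rw [le_div_iff₀ hκ]
        nlinarith [sq_nonneg (κ * ‖ζ‖ - ‖η‖)]
      have s3 := mul_le_mul_of_nonneg_left s2 (by positivity : 0 ≤ ρ ^ 2 * (1 + t))
      calc _ = 2 * inner ℝ η (-(h t • M (M (y t)))) := by ring
        _ ≤ ρ ^ 2 * (1 + t) * (2 * (‖ζ‖ * ‖η‖)) := by linarith
        _ ≤ _ := s3
        _ = _ := by ring
    have := mul_le_mul_of_nonneg_right key (Real.exp_pos (-(ρ ^ 2 * (1 + t) ^ 2 / (2 * κ)))).le
    simp only [Pi.add_apply]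
    linarith
  refine antitoneOn_of_deriv_nonpos (convex_Ici 0) ?_ ?_ ?_
  · refine ContinuousOn.mul (ContinuousOn.add ?_ ?_) (by fun_prop)
    · exact continuousOn_const.mul
        (((hhc.inv₀ fun t ht => (hpos t ht).ne').smul hyc).norm.pow 2)
    · fun_prop
  · intro t ht
    rw [interior_Ici] at ht
    obtain ⟨D, -, hD⟩ := hder t ht
    exact hD.differentiableAt.differentiableWithinAt
  · intro t ht
    rw [interior_Ici] at ht
    obtain ⟨D, hD0, hD⟩ := hder t ht
    rwa [hD.deriv]

end IsOscillator

/-! ### Growth weights, and gluing the two time regimes -/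

/-- A positive weight `h` with derivative `h'`, which grows at least like `√(1+t)` and at most like
`(1+t)^c`. -/
structure IsGrowthWeight (c : ℝ) (h h' : ℝ → ℝ) : Prop where
  zero : h 0 = 1
  pos : ∀ t, 0 ≤ t → 0 < h t
  nonneg' : ∀ t, 0 ≤ t → 0 ≤ h' t
  deriv : ∀ t, 0 ≤ t → HasDerivAt h (h' t) t
  le_sq : ∀ t, 0 ≤ t → 1 + t ≤ h t ^ 2
  mul_deriv_le : ∀ t, 0 ≤ t → (1 + t) * h' t ≤ c * h t

lemma IsGrowthWeight.monotoneOn {c : ℝ} {h h' : ℝ → ℝ} (hw : IsGrowthWeight c h h') :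
    MonotoneOn h (Ici 0) := by
  refine monotoneOn_of_deriv_nonneg (convex_Ici 0)
    (fun t ht => (hw.deriv t ht).continuousAt.continuousWithinAt) ?_ ?_
  · intro t ht
    rw [interior_Ici] at ht
    exact (hw.deriv t ht.le).differentiableAt.differentiableWithinAt
  · intro t ht
    rw [interior_Ici] at ht
    rw [(hw.deriv t ht.le).deriv]
    exact hw.nonneg' t ht.le

lemma IsGrowthWeight.deriv_zero_le {c : ℝ} {h h' : ℝ → ℝ} (hw : IsGrowthWeight c h h') :
    h' 0 ≤ c := by
  simpa [hw.zero] using hw.mul_deriv_le 0 le_rfl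

namespace IsOscillator

variable {H : Type*} [NormedAddCommGroup H] [InnerProductSpace ℝ H] {μ : ℝ} {M : H →L[ℝ] H}
  {y p : ℝ → H}

lemma norm_initial_le {c : ℝ} {h h' : ℝ → ℝ} (hw : IsGrowthWeight c h h') :
    ‖h 0 • p 0 - h' 0 • y 0‖ ≤ (1 + c) * (‖y 0‖ + ‖p 0‖) := by
  have h0 := hw.nonneg' 0 le_rfl
  have hc := hw.deriv_zero_le
  rw [hw.zero, one_smul]
  refine (norm_sub_le _ _).trans ?_
  rw [norm_smul, Real.norm_of_nonneg h0]
  nlinarith [norm_nonneg (y 0), norm_nonneg (p 0)]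

/-- While (1+T)ρ ≤ 1 the Gronwall exponent K(T) - K(0) + 2ρT is at most k + 2, which gives a
constant independent of ρ. -/
lemma low_frequency_of_solution (ho : IsOscillator μ M y p) {ρ : ℝ} (hρ : 0 < ρ)
    (hM : ∀ x, ‖M x‖ ≤ ρ * ‖x‖) {c k : ℝ} {h h' K : ℝ → ℝ} (hw : IsGrowthWeight c h h')
    (hd' : ∀ t, 0 ≤ t → HasDerivAt h' (-(μ / (1 + t) ^ 2) * h t) t)
    (hK : ∀ t, 0 ≤ t → HasDerivAt K (1 / h t ^ 2) t) (hKk : ∀ t, 0 ≤ t → K t - K 0 ≤ k)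
    {T : ℝ} (hT : 0 ≤ T) (hTρ : (1 + T) * ρ ≤ 1) :
    ‖y T‖ ≤ (2 + c) * Real.exp (k + 2) * h T * (‖y 0‖ + ‖p 0‖) ∧
    ‖h T • p T - h' T • y T‖
      ≤ (2 + c) * Real.exp (k + 2) * (1 + ρ * h T ^ 2) * (‖y 0‖ + ‖p 0‖) := by
  have key := ho.growth_of_solution hρ.le hM hw.pos hw.nonneg' hw.deriv hd' hK self_mem_Ici
    (mem_Ici.2 hT) hT
  simp only at key
  have hη := norm_initial_le (y := y) (p := p) hw
  have hc : 0 ≤ c := (hw.nonneg' 0 le_rfl).trans hw.deriv_zero_le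
  have hk : 0 ≤ k := by simpa using hKk 0 le_rfl
  set D := ‖y 0‖ + ‖p 0‖
  have hD : 0 ≤ D := by positivity
  have hσ0 : 1 ≤ 1 + ρ * h 0 ^ 2 := by nlinarith [sq_nonneg (h 0)]
  have hL0 : ‖(h 0)⁻¹ • y 0‖ ^ 2 + ‖h 0 • p 0 - h' 0 • y 0‖ ^ 2 / (1 + ρ * h 0 ^ 2) ^ 2
      ≤ ((2 + c) * D) ^ 2 := by
    have a1 : ‖(h 0)⁻¹ • y 0‖ ^ 2 ≤ D ^ 2 := by
      rw [hw.zero, inv_one, one_smul]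
      exact pow_le_pow_left₀ (norm_nonneg _) (le_add_of_nonneg_right (norm_nonneg _)) 2
    have a2 : ‖h 0 • p 0 - h' 0 • y 0‖ ^ 2 / (1 + ρ * h 0 ^ 2) ^ 2 ≤ ((1 + c) * D) ^ 2 :=
      (div_le_self (sq_nonneg _) (one_le_pow₀ hσ0)).trans (pow_le_pow_left₀ (norm_nonneg _) hη 2)
    nlinarith [mul_nonneg hc (sq_nonneg D), sq_nonneg D]
  set B := Real.exp (k + 2) with hB
  have hB1 : 1 ≤ B := Real.one_le_exp (by linarith)
  have hLT : ‖(h T)⁻¹ • y T‖ ^ 2 + ‖h T • p T - h' T • y T‖ ^ 2 / (1 + ρ * h T ^ 2) ^ 2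
      ≤ ((2 + c) * B * D) ^ 2 := by
    rw [Real.exp_neg, Real.exp_neg, ← div_eq_mul_inv, ← div_eq_mul_inv,
      div_le_div_iff₀ (Real.exp_pos _) (Real.exp_pos _)] at key
    have e1 : Real.exp (K T + 2 * ρ * T) ≤ B * Real.exp (K 0 + 2 * ρ * 0) := by
      rw [hB, ← Real.exp_add]
      refine Real.exp_le_exp.2 ?_
      nlinarith [hKk T hT]
    have e2 := Real.exp_pos (K 0 + 2 * ρ * 0)
    have e3 := mul_le_mul hL0 e1 (Real.exp_pos _).le (sq_nonneg _)
    have e4 := le_of_mul_le_mul_right ((key.trans e3).trans_eq (mul_assoc _ _ _).symm) e2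
    refine e4.trans ?_
    nlinarith [mul_nonneg (sq_nonneg ((2 + c) * D)) (mul_nonneg (by linarith : 0 ≤ B)
      (sub_nonneg.2 hB1))]
  have hR : 0 ≤ (2 + c) * B * D := by positivity
  have hhT := hw.pos T hT
  have hσ : 0 < 1 + ρ * h T ^ 2 := by positivity
  constructor
  · have : ‖(h T)⁻¹ • y T‖ ≤ (2 + c) * B * D :=
      le_of_sq_le_sq ((le_add_of_nonneg_right (by positivity)).trans hLT) hR
    rw [norm_smul, norm_inv, Real.norm_of_nonneg hhT.le, inv_mul_le_iff₀ hhT] at this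
    linarith
  · have : ‖h T • p T - h' T • y T‖ / (1 + ρ * h T ^ 2) ≤ (2 + c) * B * D :=
      le_of_sq_le_sq (by
        rw [div_pow]
        exact (le_add_of_nonneg_left (by positivity)).trans hLT) hR
    rw [div_le_iff₀ hσ] at this
    linarith

/-- Here (1+T)ρ ≤ 1 bounds the Gronwall exponent by 1/(2κ). The factor 1 + 1/κ lets one constant
serve both bounds, since ζ enters the quadratic form as κζ. The factor 1 + ρh² is slack, kept to
match the case of a positive solution. -/
lemma low_frequency_sqrt {κ : ℝ} (ho : IsOscillator (1 / 4 + κ ^ 2) M y p) (hκ : 0 < κ) {ρ : ℝ}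
    (hρ : 0 < ρ) (hM : ∀ x, ‖M x‖ ≤ ρ * ‖x‖) {c : ℝ} {h h' : ℝ → ℝ}
    (hw : IsGrowthWeight c h h') (hsq : ∀ t, 0 ≤ t → h t ^ 2 = 1 + t)
    (hd' : ∀ t, 0 ≤ t → HasDerivAt h' (-(1 / 4 / (1 + t) ^ 2) * h t) t)
    {T : ℝ} (hT : 0 ≤ T) (hTρ : (1 + T) * ρ ≤ 1) :
    ‖y T‖ ≤ (1 + 1 / κ) * (κ + 1 + c) * Real.exp (1 / (2 * κ)) * h T * (‖y 0‖ + ‖p 0‖) ∧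
    ‖h T • p T - h' T • y T‖ ≤ (1 + 1 / κ) * (κ + 1 + c) * Real.exp (1 / (2 * κ))
      * (1 + ρ * h T ^ 2) * (‖y 0‖ + ‖p 0‖) := by
  have key := ho.growth_sqrt hκ hρ.le hM hw.pos hsq hw.deriv hd' self_mem_Ici (mem_Ici.2 hT) hT
  simp only at key
  have hη := norm_initial_le (y := y) (p := p) hw
  have hc : 0 ≤ c := (hw.nonneg' 0 le_rfl).trans hw.deriv_zero_le
  set D := ‖y 0‖ + ‖p 0‖
  have hD : 0 ≤ D := by positivity
  have hL0 : κ ^ 2 * ‖(h 0)⁻¹ • y 0‖ ^ 2 + ‖h 0 • p 0 - h' 0 • y 0‖ ^ 2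
      ≤ ((κ + 1 + c) * D) ^ 2 := by
    have a1 : ‖(h 0)⁻¹ • y 0‖ ^ 2 ≤ D ^ 2 := by
      rw [hw.zero, inv_one, one_smul]
      exact pow_le_pow_left₀ (norm_nonneg _) (le_add_of_nonneg_right (norm_nonneg _)) 2
    have a2 : ‖h 0 • p 0 - h' 0 • y 0‖ ^ 2 ≤ ((1 + c) * D) ^ 2 :=
      pow_le_pow_left₀ (norm_nonneg _) hη 2
    have a3 := mul_le_mul_of_nonneg_left a1 (sq_nonneg κ)
    have a4 : 0 ≤ 2 * κ * (1 + c) * D ^ 2 := by positivity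
    nlinarith
  set B := Real.exp (1 / (2 * κ)) with hB
  have hB1 : 1 ≤ B := Real.one_le_exp (by positivity)
  have hLT : κ ^ 2 * ‖(h T)⁻¹ • y T‖ ^ 2 + ‖h T • p T - h' T • y T‖ ^ 2
      ≤ ((κ + 1 + c) * B * D) ^ 2 := by
    rw [Real.exp_neg, Real.exp_neg, ← div_eq_mul_inv, ← div_eq_mul_inv,
      div_le_div_iff₀ (Real.exp_pos _) (Real.exp_pos _)] at key
    have e1 : Real.exp (ρ ^ 2 * (1 + T) ^ 2 / (2 * κ)) ≤ B := by
      refine Real.exp_le_exp.2 (div_le_div_of_nonneg_right ?_ (by positivity))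
      rw [← mul_pow, mul_comm]
      exact pow_le_one₀ (by positivity) hTρ
    have e2 : 1 ≤ Real.exp (ρ ^ 2 * (1 + 0) ^ 2 / (2 * κ)) := Real.one_le_exp (by positivity)
    have e3 := mul_le_mul hL0 e1 (Real.exp_pos _).le (sq_nonneg _)
    have e4 := (le_mul_of_one_le_right (by positivity) e2).trans (key.trans e3)
    refine e4.trans ?_
    nlinarith [mul_nonneg (sq_nonneg ((κ + 1 + c) * D)) (mul_nonneg (by linarith : 0 ≤ B)
      (sub_nonneg.2 hB1))]
  have hR : 0 ≤ (κ + 1 + c) * B * D := by positivity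
  have hhT := hw.pos T hT
  constructor
  · have : κ * ‖(h T)⁻¹ • y T‖ ≤ (κ + 1 + c) * B * D :=
      le_of_sq_le_sq (by
        rw [mul_pow]
        exact (le_add_of_nonneg_right (by positivity)).trans hLT) hR
    rw [norm_smul, norm_inv, Real.norm_of_nonneg hhT.le, ← le_div_iff₀' hκ,
      inv_mul_le_iff₀ hhT] at this
    refine this.trans ?_
    have e : (1 + 1 / κ) * (κ + 1 + c) * B * h T * D
        = h T * ((κ + 1 + c) * B * D) + h T * ((κ + 1 + c) * B * D / κ) := by ring
    rw [e]
    exact le_add_of_nonneg_left (by positivity)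
  · have : ‖h T • p T - h' T • y T‖ ≤ (κ + 1 + c) * B * D :=
      le_of_sq_le_sq ((le_add_of_nonneg_left (by positivity)).trans hLT) hR
    refine this.trans ?_
    have e : (1 + 1 / κ) * (κ + 1 + c) * B * (1 + ρ * h T ^ 2) * D
        = (κ + 1 + c) * B * D + ((1 + 1 / κ) * (ρ * h T ^ 2) + 1 / κ) * ((κ + 1 + c) * B * D) := by
      ring
    rw [e]
    exact le_add_of_nonneg_right (by positivity)

/-- Combination of the low frequency bound, until time `1/ρ`, with the energy bound. -/
lemma norm_le_of_low_frequency (ho : IsOscillator μ M y p) (hμ : 0 ≤ μ) {ρ : ℝ} (hρ : 0 < ρ)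
    (hM : ∀ x, ‖M x‖ ≤ ρ * ‖x‖) (hy : ∀ t, ρ / 2 * ‖y t‖ ≤ ‖M (y t)‖) {A c : ℝ} (hA : 0 ≤ A)
    {h h' : ℝ → ℝ} (hw : IsGrowthWeight c h h')
    (hlow : ∀ T, 0 ≤ T → (1 + T) * ρ ≤ 1 → ‖y T‖ ≤ A * h T * (‖y 0‖ + ‖p 0‖) ∧
      ‖h T • p T - h' T • y T‖ ≤ A * (1 + ρ * h T ^ 2) * (‖y 0‖ + ‖p 0‖))
    {t : ℝ} (ht : 0 ≤ t) :
    ‖y t‖ ≤ (2 * (1 + √μ) + A + 2 * A * (3 + c + √μ)) * h t * (‖y 0‖ + ‖p 0‖) := by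
  have hc : 0 ≤ c := (hw.nonneg' 0 le_rfl).trans hw.deriv_zero_le
  set D := ‖y 0‖ + ‖p 0‖ with hDdef
  have hD : 0 ≤ D := by positivity
  have hht := hw.pos t ht
  have hh1 : 1 ≤ h t := hw.zero ▸ hw.monotoneOn self_mem_Ici (mem_Ici.2 ht) ht
  have hs := Real.sqrt_nonneg μ
  have n1 : 0 ≤ A * h t * D := by positivity
  have n2 : 0 ≤ 2 * A * (3 + c + √μ) * h t * D := by positivity
  have n3 : 0 ≤ 2 * (1 + √μ) * h t * D := by positivity
  have hsum : (2 * (1 + √μ) + A + 2 * A * (3 + c + √μ)) * h t * D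
      = 2 * (1 + √μ) * h t * D + A * h t * D + 2 * A * (3 + c + √μ) * h t * D := by ring
  rw [hsum]
  -- For ρ ≥ 1 the energy at time 0 suffices.
  rcases le_or_gt 1 ρ with h1 | h1
  · have key := ho.norm_le_of_energy hμ hρ hM hy le_rfl ht
    have e : 2 / ρ * (‖p 0‖ + ρ * ‖y 0‖ + √μ / (1 + 0) * ‖y 0‖)
        = 2 / ρ * (‖p 0‖ + √μ * ‖y 0‖) + 2 * ‖y 0‖ := by
      field_simp
      ring
    have e2 : 2 / ρ ≤ 2 := div_le_self zero_le_two h1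
    have e3 : 2 / ρ * (‖p 0‖ + √μ * ‖y 0‖) ≤ 2 * (‖p 0‖ + √μ * ‖y 0‖) := by gcongr
    have e4 : 2 * (‖p 0‖ + √μ * ‖y 0‖) + 2 * ‖y 0‖ ≤ 2 * (1 + √μ) * D := by
      rw [hDdef]
      nlinarith [mul_nonneg hs (norm_nonneg (p 0)), norm_nonneg (y 0), norm_nonneg (p 0)]
    have e5 : 2 * (1 + √μ) * D ≤ 2 * (1 + √μ) * h t * D := by
      have := mul_le_mul_of_nonneg_left hh1 (by positivity : 0 ≤ 2 * (1 + √μ) * D)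
      linarith
    linarith
  · rcases le_or_gt ((1 + t) * ρ) 1 with h2 | h2
    · have := (hlow t ht h2).1
      linarith
    -- The time at which (1+T)ρ = 1: the last one allowed for the low frequency bound, and the first
    -- at which the energy controls y without loss.
    · set T := 1 / ρ - 1 with hTdef
      have hT1 : 1 + T = 1 / ρ := by rw [hTdef]; ring
      have hT : 0 ≤ T := by
        rw [hTdef, sub_nonneg, le_div_iff₀ hρ]
        linarith
      have hTt : T ≤ t := by
        have : 1 / ρ < 1 + t := (div_lt_iff₀ hρ).2 h2
        linarith
      obtain ⟨l1, l2⟩ := hlow T hT (by rw [hT1]; field_simp; rfl)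
      have key := ho.norm_le_of_energy hμ hρ hM hy hT hTt
      have hhT := hw.pos T hT
      have hmono : h T ≤ h t := hw.monotoneOn (mem_Ici.2 hT) (mem_Ici.2 ht) hTt
      have hsq := hw.le_sq T hT
      have hdT := hw.mul_deriv_le T hT
      have hdn := hw.nonneg' T hT
      have e1 : h T * ‖p T‖ ≤ A * (1 + ρ * h T ^ 2) * D + h' T * (A * h T * D) := by
        have a1 : h T * ‖p T‖ ≤ ‖h T • p T - h' T • y T‖ + ‖h' T • y T‖ := by
          rw [← Real.norm_of_nonneg hhT.le, ← norm_smul, Real.norm_of_nonneg hhT.le]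
          simpa using norm_add_le (h T • p T - h' T • y T) (h' T • y T)
        rw [norm_smul, Real.norm_of_nonneg hdn] at a1
        have := mul_le_mul_of_nonneg_left l1 hdn
        linarith
      -- With 1/ρ = 1+T, the weight properties 1+T ≤ h² and (1+T)h' ≤ ch turn the bound on the
      -- Wronskian into ‖p(T)‖/ρ = O(h(T)).
      have e2 : 1 / ρ * ‖p T‖ ≤ A * D * (2 + c) * h T := by
        refine le_of_mul_le_mul_left ?_ hhT
        calc h T * (1 / ρ * ‖p T‖) = 1 / ρ * (h T * ‖p T‖) := by ring
          _ ≤ 1 / ρ * (A * (1 + ρ * h T ^ 2) * D + h' T * (A * h T * D)) := by gcongr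
          _ = A * D * (1 / ρ + h T ^ 2 + (1 / ρ * h' T) * h T) := by field_simp
          _ ≤ A * D * (h T ^ 2 + h T ^ 2 + c * h T * h T) := by
              rw [← hT1]
              gcongr
          _ = _ := by ring
      have e3 : 2 / ρ * (‖p T‖ + ρ * ‖y T‖ + √μ / (1 + T) * ‖y T‖)
          = 2 * (1 / ρ * ‖p T‖) + 2 * (1 + √μ) * ‖y T‖ := by
        rw [hT1]
        field_simp
        ring
      have e4 : 2 * (1 + √μ) * ‖y T‖ ≤ 2 * (1 + √μ) * (A * h T * D) := by gcongr
      have e5 : 2 * A * (3 + c + √μ) * h T * D ≤ 2 * A * (3 + c + √μ) * h t * D := by gcongr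
      have e6 : 2 * (A * D * (2 + c) * h T) + 2 * (1 + √μ) * (A * h T * D)
        = 2 * A * (3 + c + √μ) * h T * D := by ring
      linarith

end IsOscillator

/-! ### Explicit growth rates and the uniform oscillator bound -/

/-- The growth rate of solutions of `y'' + μ/(1+t)² y = 0`. -/
def growth (μ t : ℝ) : ℝ :=
  if μ = 1 / 4 then (1 + t) ^ (1 / 2 : ℝ) * (1 + Real.log (1 + t))
  else (1 + t) ^ (1 / 2 + (nu μ).re)

lemma nu_re_of_le {μ : ℝ} (hμ : μ ≤ 1 / 4) : (nu μ).re = √(1 - 4 * μ) / 2 := by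
  rw [nu, if_pos hμ]
  simp [Complex.mul_re]
  ring

lemma nu_re_of_gt {μ : ℝ} (hμ : 1 / 4 < μ) : (nu μ).re = 0 := by
  rw [nu, if_neg hμ.not_ge]
  simp [Complex.mul_re]

/-- The two factors have separate origins: undoing the Liouville transform, and the tail integral of
g(τ)(1+τ)⁻². -/
lemma rate_eq (μ μ₁ : ℝ) {t : ℝ} (ht : 0 ≤ t) :
    rate μ μ₁ t = (1 + t) ^ (-μ₁ / 2) * (growth μ t / (1 + t)) := by
  have h1 : 0 < 1 + t := by linarith
  have key : ∀ a : ℝ, (1 + t) ^ (-(1 / 2) + a - μ₁ / 2)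
      = (1 + t) ^ (-μ₁ / 2) * ((1 + t) ^ (1 / 2 + a) / (1 + t)) := by
    intro a
    rw [← Real.rpow_sub_one h1.ne', ← Real.rpow_add h1]
    congr 1
    ring
  unfold rate growth
  split_ifs
  · have := key 0
    rw [add_zero, add_zero] at this
    rw [this]
    ring
  · exact key _

lemma hasDerivAt_one_add_rpow (a : ℝ) {t : ℝ} (ht : 0 ≤ t) :
    HasDerivAt (fun t : ℝ => (1 + t) ^ a) (a * (1 + t) ^ (a - 1)) t := by
  have h1 : 1 + t ≠ 0 := by positivity
  refine (((hasDerivAt_id t).const_add 1).rpow_const (Or.inl h1)).congr_deriv ?_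
  simp

lemma isGrowthWeight_rpow {a : ℝ} (ha : 1 / 2 ≤ a) :
    IsGrowthWeight a (fun t => (1 + t) ^ a) (fun t => a * (1 + t) ^ (a - 1)) where
  zero := by simp
  pos t ht := by positivity
  nonneg' t ht := by positivity
  deriv t ht := hasDerivAt_one_add_rpow a ht
  le_sq t ht := by
    rw [← Real.rpow_natCast, ← Real.rpow_mul (by positivity)]
    conv_lhs => rw [← Real.rpow_one (1 + t)]
    refine Real.rpow_le_rpow_of_exponent_le (by linarith) ?_
    push_cast
    linarith
  mul_deriv_le t ht := by
    have : 1 + t ≠ 0 := by positivity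
    rw [Real.rpow_sub_one this]
    field_simp
    rfl

/-- The hypothesis is the indicial equation of h'' + b(1+t)⁻²h = 0, with roots 1/2 ± √(1-4b)/2. -/
lemma hasDerivAt_rpow_deriv {a b : ℝ} (hab : a * (1 - a) = b) {t : ℝ} (ht : 0 ≤ t) :
    HasDerivAt (fun t : ℝ => a * (1 + t) ^ (a - 1)) (-(b / (1 + t) ^ 2) * (1 + t) ^ a) t := by
  refine ((hasDerivAt_one_add_rpow (a - 1) ht).const_mul a).congr_deriv ?_
  have h1 : 1 + t ≠ 0 := by positivity
  rw [Real.rpow_sub_one h1, Real.rpow_sub_one h1, ← hab]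
  field_simp
  ring

lemma hasDerivAt_log_one_add {t : ℝ} (ht : 0 ≤ t) :
    HasDerivAt (fun t : ℝ => 1 + Real.log (1 + t)) (1 / (1 + t)) t := by
  have h1 : 1 + t ≠ 0 := by positivity
  exact ((((hasDerivAt_id t).const_add 1).log h1).const_add 1)

lemma one_le_one_add_log {t : ℝ} (ht : 0 ≤ t) : 1 ≤ 1 + Real.log (1 + t) := by
  have := Real.log_nonneg (by linarith : 1 ≤ 1 + t)
  linarith

/-- At the double root 1/2 the growing solution carries a logarithm. With L = 1 + log(1+t) ≥ 1, the
constant 3/2 comes from L/2 + 1 ≤ 3L/2. -/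
lemma isGrowthWeight_log :
    IsGrowthWeight (3 / 2) (fun t => (1 + t) ^ (1 / 2 : ℝ) * (1 + Real.log (1 + t)))
      (fun t => (1 + t) ^ (1 / 2 : ℝ) / (1 + t) * ((1 + Real.log (1 + t)) / 2 + 1)) where
  zero := by simp
  pos t ht := by
    have := one_le_one_add_log ht
    positivity
  nonneg' t ht := by
    have := one_le_one_add_log ht
    positivity
  deriv t ht := by
    have h1 : 1 + t ≠ 0 := by positivity
    refine ((hasDerivAt_one_add_rpow (1 / 2) ht).mul (hasDerivAt_log_one_add ht)).congr_deriv ?_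
    rw [Real.rpow_sub_one h1]
    ring
  le_sq t ht := by
    have := one_le_one_add_log ht
    rw [mul_pow, ← Real.sqrt_eq_rpow, Real.sq_sqrt (by linarith)]
    exact le_mul_of_one_le_right (by linarith) (one_le_pow₀ this)
  mul_deriv_le t ht := by
    have := one_le_one_add_log ht
    have h1 : 0 < 1 + t := by positivity
    have e : (1 + t) * ((1 + t) ^ (1 / 2 : ℝ) / (1 + t) * ((1 + Real.log (1 + t)) / 2 + 1))
        = (1 + t) ^ (1 / 2 : ℝ) * ((1 + Real.log (1 + t)) / 2 + 1) := by field_simp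
    rw [e]
    have h2 : 0 ≤ (1 + t) ^ (1 / 2 : ℝ) := by positivity
    nlinarith

lemma hasDerivAt_log_deriv {t : ℝ} (ht : 0 ≤ t) :
    HasDerivAt (fun t : ℝ => (1 + t) ^ (1 / 2 : ℝ) / (1 + t) * ((1 + Real.log (1 + t)) / 2 + 1))
      (-(1 / 4 / (1 + t) ^ 2) * ((1 + t) ^ (1 / 2 : ℝ) * (1 + Real.log (1 + t)))) t := by
  have h1 : 1 + t ≠ 0 := by positivity
  refine (((hasDerivAt_one_add_rpow (1 / 2) ht).div ((hasDerivAt_id t).const_add 1) h1).mul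
    (((hasDerivAt_log_one_add ht).div_const 2).add_const 1)).congr_deriv ?_
  rw [Real.rpow_sub_one h1]
  simp only [id, Pi.div_apply]
  field_simp
  ring

/-- All oscillators with `ρ/2 ≤ M ≤ ρ` for some `ρ > 0` grow at most at the rate `growth μ`,
with the constant `C`. -/
def OscillatorBound (μ C : ℝ) : Prop :=
  ∀ (H : Type) [NormedAddCommGroup H] [InnerProductSpace ℝ H] (M : H →L[ℝ] H) (y p : ℝ → H)
    (ρ : ℝ), IsOscillator μ M y p → 0 < ρ → (∀ x, ‖M x‖ ≤ ρ * ‖x‖) →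
    (∀ t, ρ / 2 * ‖y t‖ ≤ ‖M (y t)‖) → ∀ t, 0 ≤ t →
    ‖y t‖ ≤ C * growth μ t * (‖y 0‖ + ‖p 0‖)

lemma growth_nonneg (μ : ℝ) {t : ℝ} (ht : 0 ≤ t) : 0 ≤ growth μ t := by
  have := one_le_one_add_log ht
  unfold growth
  split_ifs <;> positivity

/-- Uniform bounds for oscillators, and a primitive of `μ (1+t)⁻²` times the growth rate. -/
theorem exists_growth_bound {μ : ℝ} (hμ : 0 ≤ μ) : ∃ C : ℝ, 0 < C ∧
    (∃ Q : ℝ → ℝ, (∀ t, 0 ≤ t → HasDerivAt Q (-(μ / (1 + t) ^ 2) * growth μ t) t) ∧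
      (∀ t, 0 ≤ t → 0 ≤ Q t ∧ Q t ≤ C * μ * (growth μ t / (1 + t)))) ∧
    OscillatorBound μ C := by
  -- The three ranges of μ differ only in the low frequency bound and in the equation of the weight,
  -- whose coefficient b need not be μ.
  suffices hmain : ∃ A c h', 0 ≤ A ∧ IsGrowthWeight c (growth μ) h' ∧
      (μ = 0 ∨ ∃ b, 0 < b ∧ ∀ t, 0 ≤ t → HasDerivAt h' (-(b / (1 + t) ^ 2) * growth μ t) t) ∧
      ∀ (H : Type) [NormedAddCommGroup H] [InnerProductSpace ℝ H] (M : H →L[ℝ] H) (y p : ℝ → H)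
      (ρ : ℝ), IsOscillator μ M y p → 0 < ρ → (∀ x, ‖M x‖ ≤ ρ * ‖x‖) →
      ∀ T, 0 ≤ T → (1 + T) * ρ ≤ 1 → ‖y T‖ ≤ A * growth μ T * (‖y 0‖ + ‖p 0‖) ∧
      ‖growth μ T • p T - h' T • y T‖ ≤ A * (1 + ρ * growth μ T ^ 2) * (‖y 0‖ + ‖p 0‖) by
    obtain ⟨A, c, h', hA, hw, hb, hlow⟩ := hmain
    have hc : 0 ≤ c := (hw.nonneg' 0 le_rfl).trans hw.deriv_zero_le
    have hpos : ∀ t, 0 ≤ t → 0 ≤ growth μ t / (1 + t) := fun t ht => by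
      have := hw.pos t ht
      positivity
    obtain ⟨c₁, hc₁, Q, hQ, hQ'⟩ : ∃ c₁, 0 ≤ c₁ ∧ ∃ Q : ℝ → ℝ,
        (∀ t, 0 ≤ t → HasDerivAt Q (-(μ / (1 + t) ^ 2) * growth μ t) t) ∧
        (∀ t, 0 ≤ t → 0 ≤ Q t ∧ Q t ≤ c₁ * μ * (growth μ t / (1 + t))) := by
      rcases hb with rfl | ⟨b, hb0, hb⟩
      -- For μ = 0 the growth 1+t has constant derivative, useless as a decaying primitive, but the
      -- integrand vanishes.
      · exact ⟨0, le_rfl, 0, fun t _ => by simp, fun t _ => by simp⟩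
      -- As h'' = -b(1+t)⁻²h, a multiple of h' is the primitive, and (1+t)h' ≤ ch gives its decay.
      · refine ⟨c / b, by positivity, fun t => μ / b * h' t, fun t ht => ?_, fun t ht => ⟨?_, ?_⟩⟩
        · refine ((hb t ht).const_mul (μ / b)).congr_deriv ?_
          field_simp
        · exact mul_nonneg (by positivity) (hw.nonneg' t ht)
        · have h1 : 0 < 1 + t := by linarith
          have h2 : h' t ≤ c * (growth μ t / (1 + t)) := by
            rw [← mul_div_assoc, le_div_iff₀ h1, mul_comm]
            exact hw.mul_deriv_le t ht
          calc μ / b * h' t ≤ μ / b * (c * (growth μ t / (1 + t))) := by gcongr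
            _ = c / b * μ * (growth μ t / (1 + t)) := by ring
    have hs := Real.sqrt_nonneg μ
    refine ⟨2 * (1 + √μ) + A + 2 * A * (3 + c + √μ) + c₁, by positivity, ⟨Q, hQ, fun t ht =>
      ⟨(hQ' t ht).1, (hQ' t ht).2.trans ?_⟩⟩, ?_⟩
    · have := hpos t ht
      gcongr
      exact le_add_of_nonneg_left (by positivity)
    · intro H _ _ M y p ρ ho hρ hM hy t ht
      refine (ho.norm_le_of_low_frequency hμ hρ hM hy hA hw (hlow H M y p ρ ho hρ hM) ht).trans ?_
      have := (hw.pos t ht).le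
      exact mul_le_mul_of_nonneg_right
        (mul_le_mul_of_nonneg_right (le_add_of_nonneg_right hc₁) this) (by positivity)
  rcases lt_trichotomy μ (1 / 4) with h4 | h4 | h4
  · set s := √(1 - 4 * μ) with hs
    have hs0 : 0 < s := Real.sqrt_pos.2 (by linarith)
    have hsq : s ^ 2 = 1 - 4 * μ := Real.sq_sqrt (by linarith)
    have hg : growth μ = fun t => (1 + t) ^ (1 / 2 + s / 2) := by
      funext t
      rw [growth, if_neg h4.ne, nu_re_of_le h4.le]
    have hab : (1 / 2 + s / 2) * (1 - (1 / 2 + s / 2)) = μ := by linarith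
    set a := 1 / 2 + s / 2 with ha
    have hw := isGrowthWeight_rpow (a := a) (by linarith)
    have hd' := fun t ht => hasDerivAt_rpow_deriv hab (t := t) ht
    rw [hg]
    refine ⟨(2 + a) * Real.exp (1 / s + 2), a, _, by positivity, hw, ?_, ?_⟩
    · rcases eq_or_ne μ 0 with h0 | h0
      · exact Or.inl h0
      · exact Or.inr ⟨μ, lt_of_le_of_ne hμ h0.symm, hd'⟩
    · intro H _ _ M y p ρ ho hρ hM T hT hTρ
      -- Since 2a = 1 + s, one has h⁻² = (1+t)^{-1-s}; this primitive increases by at most 1/s.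
      refine ho.low_frequency_of_solution hρ hM (K := fun t => -(1 / s) * (1 + t) ^ (-s)) hw hd'
        (fun t ht => ?_) (fun t ht => ?_) hT hTρ
      · refine ((hasDerivAt_one_add_rpow (-s) ht).const_mul (-(1 / s))).congr_deriv ?_
        have h1 : 0 < 1 + t := by positivity
        rw [← Real.rpow_natCast, ← Real.rpow_mul h1.le, one_div ((1 + t) ^ _), ← Real.rpow_neg h1.le]
        have e : -(a * ((2 : ℕ) : ℝ)) = -s - 1 := by rw [ha]; push_cast; ring
        rw [e]
        field_simp
      · have : 0 ≤ 1 / s * (1 + t) ^ (-s) := by positivity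
        simp only [add_zero, Real.one_rpow]
        linarith
  · subst h4
    have hg : growth (1 / 4) = fun t => (1 + t) ^ (1 / 2 : ℝ) * (1 + Real.log (1 + t)) := by
      funext t
      rw [growth, if_pos rfl]
    rw [hg]
    refine ⟨(2 + 3 / 2) * Real.exp (1 + 2), 3 / 2, _, by positivity, isGrowthWeight_log,
      Or.inr ⟨1 / 4, by norm_num, fun t ht => hasDerivAt_log_deriv ht⟩, ?_⟩
    intro H _ _ M y p ρ ho hρ hM T hT hTρ
    -- The logarithm makes h⁻² = (1+t)⁻¹(1 + log(1+t))⁻² integrable, with total mass 1.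
    refine ho.low_frequency_of_solution hρ hM (K := fun t => -(1 + Real.log (1 + t))⁻¹)
      isGrowthWeight_log (fun t ht => hasDerivAt_log_deriv ht) (fun t ht => ?_) (fun t ht => ?_)
      hT hTρ
    · have h2 := one_le_one_add_log ht
      have h1 : 0 < 1 + t := by positivity
      refine ((hasDerivAt_log_one_add ht).inv (by positivity)).neg.congr_deriv ?_
      rw [mul_pow, ← Real.sqrt_eq_rpow, Real.sq_sqrt h1.le]
      field_simp
    · have h2 := one_le_one_add_log ht
      have : 0 ≤ (1 + Real.log (1 + t))⁻¹ := by positivity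
      simp only [add_zero, Real.log_one, inv_one]
      linarith
  · have hg : growth μ = fun t => (1 + t) ^ (1 / 2 : ℝ) := by
      funext t
      rw [growth, if_neg h4.ne', nu_re_of_gt h4, add_zero]
    have hκ : 0 < √(μ - 1 / 4) := Real.sqrt_pos.2 (by linarith)
    have hμκ : μ = 1 / 4 + √(μ - 1 / 4) ^ 2 := by rw [Real.sq_sqrt (by linarith)]; ring
    set κ := √(μ - 1 / 4)
    have hw := isGrowthWeight_rpow (a := 1 / 2) le_rfl
    have hd' := fun t ht => hasDerivAt_rpow_deriv (a := 1 / 2) (b := 1 / 4) (by norm_num) (t := t) ht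
    rw [hg]
    refine ⟨(1 + 1 / κ) * (κ + 1 + 1 / 2) * Real.exp (1 / (2 * κ)), 1 / 2, _, by positivity, hw,
      Or.inr ⟨1 / 4, by norm_num, hd'⟩, ?_⟩
    intro H _ _ M y p ρ ho hρ hM T hT hTρ
    rw [hμκ] at ho
    refine ho.low_frequency_sqrt hκ hρ hM hw (fun t ht => ?_) hd' hT hTρ
    rw [← Real.sqrt_eq_rpow, Real.sq_sqrt (by positivity)]

/-! ### Bounded Fourier multipliers and frequency decompositions -/

section Multiplier

variable {d : ℕ} {m n k : Space d → ℂ} {f g : L2 d}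

/-- The symbol of a bounded multiplication operator. -/
def IsMultiplier (m : Space d → ℂ) : Prop := Measurable m ∧ ∃ C, ∀ ξ, ‖m ξ‖ ≤ C

lemma IsMultiplier.memLp (hm : IsMultiplier m) (f : L2 d) :
    MemLp (fun ξ => m ξ * f ξ) 2 volume := by
  obtain ⟨hm, C, hC⟩ := hm
  refine (Lp.memLp f).of_le_mul (c := C) (hm.aestronglyMeasurable.mul (Lp.memLp f).1)
    (Filter.Eventually.of_forall fun ξ => ?_)
  rw [norm_mul]
  exact mul_le_mul_of_nonneg_right (hC ξ) (norm_nonneg _)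

open Classical in
/-- Multiplication by a bounded symbol, on the frequency side `L²`. -/
def mulL (m : Space d → ℂ) : L2 d →L[ℝ] L2 d :=
  if hm : IsMultiplier m then
    LinearMap.mkContinuous
      { toFun := fun f => (hm.memLp f).toLp
        map_add' := fun f g => by
          rw [← MemLp.toLp_add, MemLp.toLp_eq_toLp_iff]
          filter_upwards [Lp.coeFn_add f g] with ξ h
          simp only [h, Pi.add_apply, mul_add]
        map_smul' := fun c f => by
          rw [RingHom.id_apply, ← MemLp.toLp_const_smul, MemLp.toLp_eq_toLp_iff]
          filter_upwards [Lp.coeFn_smul c f] with ξ h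
          simp only [h, Pi.smul_apply, Complex.real_smul]
          ring }
      hm.2.choose (fun f => Lp.norm_le_mul_norm_of_ae_le_mul (by
        filter_upwards [(hm.memLp f).coeFn_toLp] with ξ h
        simp only [LinearMap.coe_mk, AddHom.coe_mk, h, norm_mul]
        exact mul_le_mul_of_nonneg_right (hm.2.choose_spec ξ) (norm_nonneg _)))
  else 0

lemma mulL_ae (hm : IsMultiplier m) (f : L2 d) : mulL m f =ᵐ[volume] fun ξ => m ξ * f ξ := by
  rw [mulL, dif_pos hm]
  exact (hm.memLp f).coeFn_toLp

lemma norm_le_of_ae {C : ℝ} {u v : L2 d} (h : ∀ᵐ ξ, ‖u ξ‖ ≤ C * ‖v ξ‖) : ‖u‖ ≤ C * ‖v‖ :=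
  Lp.norm_le_mul_norm_of_ae_le_mul h

lemma norm_mulL_le (hm : IsMultiplier m) {C : ℝ} (hC : ∀ ξ, ‖m ξ‖ ≤ C) (f : L2 d) :
    ‖mulL m f‖ ≤ C * ‖f‖ := by
  refine norm_le_of_ae ?_
  filter_upwards [mulL_ae hm f] with ξ h
  rw [h, norm_mul]
  exact mul_le_mul_of_nonneg_right (hC ξ) (norm_nonneg _)

lemma mulL_mulL (hm : IsMultiplier m) (hn : IsMultiplier n) (hk : IsMultiplier k)
    (h : ∀ ξ, m ξ * n ξ = k ξ) (f : L2 d) : mulL m (mulL n f) = mulL k f := by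
  refine Lp.ext ?_
  filter_upwards [mulL_ae hm (mulL n f), mulL_ae hn f, mulL_ae hk f] with ξ h1 h2 h3
  rw [h1, h2, h3, ← h, mul_assoc]

lemma inner_mulL (hm : IsMultiplier m) (hr : ∀ ξ, (m ξ).im = 0) (f g : L2 d) :
    inner ℝ (mulL m f) g = inner ℝ f (mulL m g) := by
  rw [L2.inner_def, L2.inner_def]
  refine integral_congr_ae ?_
  filter_upwards [mulL_ae hm f, mulL_ae hm g] with ξ h1 h2
  rw [h1, h2, Complex.inner, Complex.inner]
  simp only [map_mul, Complex.mul_re, Complex.mul_im, Complex.conj_re, Complex.conj_im, hr]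
  ring

lemma norm_sq_eq_integral (f : L2 d) : ‖f‖ ^ 2 = ∫ ξ, ‖f ξ‖ ^ 2 := by
  rw [← real_inner_self_eq_norm_sq, L2.inner_def]
  simp_rw [real_inner_self_eq_norm_sq]

lemma integrable_norm_sq (f : L2 d) : Integrable (fun ξ => ‖f ξ‖ ^ 2) volume :=
  (memLp_two_iff_integrable_sq_norm (Lp.memLp f).1).1 (Lp.memLp f)

/-- The indicator of a set of frequencies, as a symbol. -/
def cutoff (S : Set (Space d)) : Space d → ℂ := S.indicator 1

lemma isMultiplier_cutoff {S : Set (Space d)} (hS : MeasurableSet S) :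
    IsMultiplier (cutoff S) := by
  refine ⟨(measurable_const (a := (1 : ℂ))).indicator hS, 1, fun ξ => ?_⟩
  by_cases h : ξ ∈ S <;> simp [cutoff, h]

lemma norm_cutoff_le (S : Set (Space d)) (ξ : Space d) : ‖cutoff S ξ‖ ≤ 1 := by
  by_cases h : ξ ∈ S <;> simp [cutoff, h]

/-- A symbol that is bounded on `S`, cut off to `S`. -/
lemma isMultiplier_cutoff_mul {S : Set (Space d)} (hS : MeasurableSet S) (hm : Measurable m)
    {C : ℝ} (hC0 : 0 ≤ C) (hC : ∀ ξ ∈ S, ‖m ξ‖ ≤ C) :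
    IsMultiplier (fun ξ => cutoff S ξ * m ξ) ∧ ∀ ξ, ‖cutoff S ξ * m ξ‖ ≤ C := by
  have : ∀ ξ, ‖cutoff S ξ * m ξ‖ ≤ C := fun ξ => by
    by_cases h : ξ ∈ S
    · simpa [cutoff, h] using hC ξ h
    · simpa [cutoff, h] using hC0
  exact ⟨⟨(isMultiplier_cutoff hS).1.mul hm, C, this⟩, this⟩

lemma norm_sq_mulL_cutoff {S : Set (Space d)} (hS : MeasurableSet S) (f : L2 d) :
    ‖mulL (cutoff S) f‖ ^ 2 = ∫ ξ in S, ‖f ξ‖ ^ 2 := by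
  rw [norm_sq_eq_integral, ← integral_indicator hS]
  refine integral_congr_ae ?_
  filter_upwards [mulL_ae (isMultiplier_cutoff hS) f] with ξ h
  rw [h]
  by_cases hξ : ξ ∈ S <;> simp [cutoff, hξ]

lemma measurable_absGrad : Measurable (absGrad : Space d → ℝ) := continuous_absGrad.measurable

lemma absGrad_nonneg (ξ : Space d) : 0 ≤ absGrad ξ := by
  unfold absGrad; positivity

lemma ae_absGrad_pos (hd : 1 ≤ d) : ∀ᵐ ξ : Space d, 0 < absGrad ξ := by
  have : Nonempty (Fin d) := ⟨⟨0, hd⟩⟩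
  have h : ∀ᵐ ξ : Space d, ξ ≠ 0 := by
    rw [ae_iff]
    simp
  filter_upwards [h] with ξ hξ
  have := norm_pos_iff.2 hξ
  unfold absGrad
  positivity

/-- The dyadic shell `2^j ≤ |∇| < 2^(j+1)`. -/
def shell (d : ℕ) (j : ℤ) : Set (Space d) := absGrad ⁻¹' Ico ((2 : ℝ) ^ j) (2 ^ (j + 1))

lemma measurableSet_shell (j : ℤ) : MeasurableSet (shell d j) :=
  measurable_absGrad measurableSet_Ico

/-- The shells are disjoint and miss only the zero frequency, a null set because d ≥ 1. -/
lemma hasSum_shell (hd : 1 ≤ d) (f : L2 d) :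
    HasSum (fun j => ‖mulL (cutoff (shell d j)) f‖ ^ 2) (‖f‖ ^ 2) := by
  have h := hasSum_integral_iUnion (f := fun ξ => ‖f ξ‖ ^ 2) (μ := (volume : Measure (Space d)))
    (measurableSet_shell (d := d)) (fun i j hij => Set.disjoint_left.2 fun ξ hi hj => ?_)
    (integrable_norm_sq f).integrableOn
  · have hU : (⋃ j, shell d j) =ᵐ[volume] univ := by
      rw [Filter.eventuallyEq_univ]
      filter_upwards [ae_absGrad_pos hd] with ξ hξ
      obtain ⟨j, hj⟩ := exists_mem_Ico_zpow hξ one_lt_two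
      exact mem_iUnion.2 ⟨j, hj⟩
    rw [setIntegral_congr_set hU, setIntegral_univ, ← norm_sq_eq_integral] at h
    simpa only [norm_sq_mulL_cutoff (measurableSet_shell _)] using h
  · have h1 := (zpow_lt_zpow_iff_right₀ (one_lt_two (α := ℝ))).1 (hi.1.trans_lt hj.2)
    have h2 := (zpow_lt_zpow_iff_right₀ (one_lt_two (α := ℝ))).1 (hj.1.trans_lt hi.2)
    omega

/-- The ball `|∇| ≤ N` of frequencies. -/
def freqBall (d N : ℕ) : Set (Space d) := absGrad ⁻¹' Iic (N : ℝ)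

lemma measurableSet_freqBall (N : ℕ) : MeasurableSet (freqBall d N) :=
  measurable_absGrad measurableSet_Iic

/-- Monotone exhaustion: estimates proved where |∇| is bounded, uniformly in the bound, hold in all
of L². -/
lemma norm_le_of_freqBall {f : L2 d} {C : ℝ} (hC : 0 ≤ C)
    (h : ∀ N, ‖mulL (cutoff (freqBall d N)) f‖ ≤ C) : ‖f‖ ≤ C := by
  refine le_of_sq_le_sq ?_ hC
  have hmono : Monotone (freqBall d) := fun a b hab ξ (hξ : absGrad ξ ≤ a) =>
    hξ.trans (Nat.cast_le.2 hab)
  have hlim := tendsto_setIntegral_of_monotone (f := fun ξ => ‖f ξ‖ ^ 2)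
    (μ := (volume : Measure (Space d))) measurableSet_freqBall hmono
    (integrable_norm_sq f).integrableOn
  have hU : (⋃ N, freqBall d N) = univ := eq_univ_of_forall fun ξ => by
    obtain ⟨N, hN⟩ := exists_nat_ge (absGrad ξ)
    exact mem_iUnion.2 ⟨N, hN⟩
  rw [hU, setIntegral_univ, ← norm_sq_eq_integral] at hlim
  refine le_of_tendsto' hlim fun N => ?_
  rw [← norm_sq_mulL_cutoff (measurableSet_freqBall N)]
  exact pow_le_pow_left₀ (norm_nonneg _) (h N) 2

end Multiplier

/-! ### Spectral solutions and their restriction to bounded frequencies -/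

/-- `Y`, with derivative `P`, is the Fourier transform of a solution of `w'' - Δw + μ/(1+t)² w = 0` in
the energy class, and `B` the Fourier transform of `|∇| w`. The equation for `P` is integrated in
time. -/
structure IsSpectralSolution {d : ℕ} (μ : ℝ) (Y P B : ℝ → L2 d) : Prop where
  cont : ContinuousOn Y (Ici 0)
  cont_deriv : ContinuousOn P (Ici 0)
  cont_grad : ContinuousOn B (Ici 0)
  deriv : ∀ t, 0 < t → HasDerivAt Y (P t) t
  grad : ∀ t, 0 ≤ t → B t =ᵐ[volume] fun ξ => (absGrad ξ : ℂ) * Y t ξ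
  -- The symbol |∇| stays outside the time integral: B is L² valued, whereas |∇|B(τ) need not be in
  -- L².
  equation : ∀ t, 0 ≤ t →
    (P t - P 0 + ∫ τ in (0 : ℝ)..t, (μ / (1 + τ) ^ 2) • Y τ : L2 d) =ᵐ[volume]
      fun ξ => -((absGrad ξ : ℂ) * (∫ τ in (0 : ℝ)..t, B τ : L2 d) ξ)

section

variable {d : ℕ} {μ : ℝ} {Y P B : ℝ → L2 d}

lemma measurable_absGrad_coe : Measurable fun ξ : Space d => (absGrad ξ : ℂ) :=
  Complex.measurable_ofReal.comp measurable_absGrad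

lemma norm_absGrad_coe (ξ : Space d) : ‖(absGrad ξ : ℂ)‖ = absGrad ξ := by
  rw [Complex.norm_real, Real.norm_of_nonneg (absGrad_nonneg ξ)]

lemma cutoff_mul_self (S : Set (Space d)) (ξ : Space d) :
    cutoff S ξ * cutoff S ξ = cutoff S ξ := by
  by_cases h : ξ ∈ S <;> simp [cutoff, h]

/-- The operator `|∇|`, cut off to `S`. -/
abbrev gradL (S : Set (Space d)) : L2 d →L[ℝ] L2 d := mulL fun ξ => cutoff S ξ * (absGrad ξ : ℂ)

lemma isMultiplier_grad {S : Set (Space d)} (hS : MeasurableSet S) {N : ℝ} (hN0 : 0 ≤ N)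
    (hN : ∀ ξ ∈ S, absGrad ξ ≤ N) :
    IsMultiplier (fun ξ => cutoff S ξ * (absGrad ξ : ℂ)) ∧
      ∀ ξ, ‖cutoff S ξ * (absGrad ξ : ℂ)‖ ≤ N :=
  isMultiplier_cutoff_mul hS measurable_absGrad_coe hN0 fun ξ hξ => by
    rw [norm_absGrad_coe]; exact hN ξ hξ

namespace IsSpectralSolution

lemma gradL_apply (h : IsSpectralSolution μ Y P B) {S : Set (Space d)} (hS : MeasurableSet S)
    {N : ℝ} (hN0 : 0 ≤ N) (hN : ∀ ξ ∈ S, absGrad ξ ≤ N) {t : ℝ} (ht : 0 ≤ t) :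
    gradL S (mulL (cutoff S) (Y t)) = mulL (cutoff S) (B t) := by
  have hm := (isMultiplier_grad hS hN0 hN).1
  have hc := isMultiplier_cutoff hS
  refine Lp.ext ?_
  filter_upwards [mulL_ae hm (mulL (cutoff S) (Y t)), mulL_ae hc (Y t), mulL_ae hc (B t),
    h.grad t ht] with ξ h1 h2 h3 h4
  rw [h1, h2, h3, h4]
  linear_combination (absGrad ξ : ℂ) * Y t ξ * cutoff_mul_self S ξ

/-- The part of a spectral solution in a bounded set of frequencies is an oscillator. -/
lemma isOscillator (h : IsSpectralSolution μ Y P B) {S : Set (Space d)} (hS : MeasurableSet S)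
    {N : ℝ} (hN0 : 0 ≤ N) (hN : ∀ ξ ∈ S, absGrad ξ ≤ N) :
    IsOscillator μ (gradL S) (fun t => mulL (cutoff S) (Y t)) (fun t => mulL (cutoff S) (P t)) := by
  have hm := (isMultiplier_grad hS hN0 hN).1
  have hc := isMultiplier_cutoff hS
  refine ⟨inner_mulL hm fun ξ => ?_, (mulL (cutoff S)).continuous.comp_continuousOn h.cont,
    (mulL (cutoff S)).continuous.comp_continuousOn h.cont_deriv,
    fun t ht => (mulL (cutoff S)).hasFDerivAt.comp_hasDerivAt t (h.deriv t ht), fun t ht => ?_⟩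
  · by_cases hξ : ξ ∈ S <;> simp [cutoff, hξ]
  have hV : ContinuousOn (fun τ => (μ / (1 + τ) ^ 2) • Y τ) (Ici 0) := by
    refine ContinuousOn.smul (f := fun τ : ℝ => μ / (1 + τ) ^ 2)
      (ContinuousOn.div (by fun_prop) (by fun_prop) fun t ht => ?_) h.cont
    have : 0 ≤ t := ht
    positivity
  -- After the cutoff |∇| is bounded and enters the integral. The integrand G is then continuous in
  -- L², so the integrated equation can be differentiated in norm.
  set G : ℝ → L2 d := fun τ =>
    -(mulL (cutoff S) ((μ / (1 + τ) ^ 2) • Y τ)) - gradL S (B τ) with hG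
  have hGc : ContinuousOn G (Ici 0) :=
    ((mulL (cutoff S)).continuous.comp_continuousOn hV).neg.sub
      ((gradL S).continuous.comp_continuousOn h.cont_grad)
  have hint : ∀ {f : ℝ → L2 d}, ContinuousOn f (Ici 0) → ∀ s, 0 ≤ s →
      IntervalIntegrable f volume 0 s := fun hf s hs =>
    (hf.mono (by rw [uIcc_of_le hs]; exact Icc_subset_Ici_self)).intervalIntegrable
  have hrep : ∀ s, 0 ≤ s → mulL (cutoff S) (P s) = mulL (cutoff S) (P 0) + ∫ τ in (0 : ℝ)..s, G τ := by
    intro s hs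
    have e1 : ∫ τ in (0 : ℝ)..s, G τ
        = -(mulL (cutoff S) (∫ τ in (0 : ℝ)..s, (μ / (1 + τ) ^ 2) • Y τ))
          - gradL S (∫ τ in (0 : ℝ)..s, B τ) := by
      rw [hG, intervalIntegral.integral_sub, intervalIntegral.integral_neg,
        ContinuousLinearMap.intervalIntegral_comp_comm _ (hint hV s hs),
        ContinuousLinearMap.intervalIntegral_comp_comm _ (hint h.cont_grad s hs)]
      · exact hint ((mulL (cutoff S)).continuous.comp_continuousOn hV).neg s hs
      · exact hint ((gradL S).continuous.comp_continuousOn h.cont_grad) s hs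
    have e2 : mulL (cutoff S) (P s - P 0 + ∫ τ in (0 : ℝ)..s, (μ / (1 + τ) ^ 2) • Y τ)
        = -gradL S (∫ τ in (0 : ℝ)..s, B τ) := by
      refine Lp.ext ?_
      filter_upwards [mulL_ae hc (P s - P 0 + ∫ τ in (0 : ℝ)..s, (μ / (1 + τ) ^ 2) • Y τ),
        Lp.coeFn_neg (gradL S (∫ τ in (0 : ℝ)..s, B τ)), mulL_ae hm (∫ τ in (0 : ℝ)..s, B τ),
        h.equation s hs] with ξ h1 h2 h3 h4
      rw [h1, h2, Pi.neg_apply, h3, h4]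
      ring
    rw [map_add, map_sub] at e2
    rw [e1, sub_eq_add_neg, ← e2]
    abel
  have hGd : HasDerivAt (fun s => ∫ τ in (0 : ℝ)..s, G τ) (G t) t := by
    refine intervalIntegral.integral_hasDerivAt_right (hint hGc t ht.le) ?_
      (hGc.continuousAt (Ici_mem_nhds ht))
    exact (hGc.mono Ioi_subset_Ici_self).stronglyMeasurableAtFilter isOpen_Ioi t ht
  have hG' : G t = -((μ / (1 + t) ^ 2) • mulL (cutoff S) (Y t))
      - gradL S (gradL S (mulL (cutoff S) (Y t))) := by
    rw [h.gradL_apply hS hN0 hN ht.le, mulL_mulL hm hc hm (fun ξ => ?_), hG]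
    · simp only [map_smul]
    · rw [mul_right_comm, cutoff_mul_self]
  rw [← hG']
  refine (hGd.const_add (mulL (cutoff S) (P 0))).congr_of_eventuallyEq ?_
  filter_upwards [Ioi_mem_nhds ht] with s hs
  exact hrep s (le_of_lt hs)

end IsSpectralSolution

end

/-! ### Summation over dyadic shells, and differentiation of phases -/

section

variable {d : ℕ} {μ : ℝ} {Y P B : ℝ → L2 d}

/-- Solutions of the Liouville-transformed equation grow at most at the rate `growth μ` in `L²`. -/
lemma IsSpectralSolution.norm_le (h : IsSpectralSolution μ Y P B) (hd : 1 ≤ d) {C : ℝ} (hC : 0 < C)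
    (hosc : OscillatorBound μ C) {t : ℝ} (ht : 0 ≤ t) :
    ‖Y t‖ ≤ 2 * C * (‖Y 0‖ + ‖P 0‖) * growth μ t := by
  have hg := growth_nonneg μ ht
  set K := C * growth μ t with hK
  have hK0 : 0 ≤ K := by positivity
  have hshell : ∀ j, ‖mulL (cutoff (shell d j)) (Y t)‖ ^ 2
      ≤ 2 * K ^ 2 * (‖mulL (cutoff (shell d j)) (Y 0)‖ ^ 2
        + ‖mulL (cutoff (shell d j)) (P 0)‖ ^ 2) := by
    intro j
    have hρ : (0 : ℝ) < 2 ^ (j + 1) := by positivity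
    have hS := measurableSet_shell (d := d) j
    have hN : ∀ ξ ∈ shell d j, absGrad ξ ≤ (2 : ℝ) ^ (j + 1) := fun ξ hξ => hξ.2.le
    obtain ⟨hm, hmb⟩ := isMultiplier_grad hS hρ.le hN
    have hc := isMultiplier_cutoff hS
    have key := hosc (L2 d) _ _ _ _ (h.isOscillator hS hρ.le hN) hρ (norm_mulL_le hm hmb)
      (fun s => ?_) t ht
    · calc _ ≤ (K * (‖mulL (cutoff (shell d j)) (Y 0)‖ + ‖mulL (cutoff (shell d j)) (P 0)‖)) ^ 2 :=
            pow_le_pow_left₀ (norm_nonneg _) key 2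
        _ ≤ _ := by
            rw [mul_pow]
            nlinarith [mul_nonneg (sq_nonneg K) (sq_nonneg (‖mulL (cutoff (shell d j)) (Y 0)‖
              - ‖mulL (cutoff (shell d j)) (P 0)‖))]
    · rw [mul_comm, ← le_div_iff₀ (by positivity), div_eq_inv_mul]
      refine norm_le_of_ae ?_
      filter_upwards [mulL_ae hm (mulL (cutoff (shell d j)) (Y s)), mulL_ae hc (Y s)] with ξ h1 h2
      rw [h1, h2, ← div_eq_inv_mul, le_div_iff₀ (by positivity), mul_comm]
      by_cases hξ : ξ ∈ shell d j
      · have hlow : (2 : ℝ) ^ (j + 1) / 2 ≤ absGrad ξ := by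
          rw [zpow_add_one₀ two_ne_zero, mul_div_cancel_right₀ _ two_ne_zero]
          exact hξ.1
        simp only [cutoff, indicator_of_mem hξ, Pi.one_apply, one_mul, norm_mul, norm_absGrad_coe]
        gcongr
      · simp [cutoff, hξ]
  -- The bound (a+b)² ≤ 2(a²+b²) on each shell costs a factor √2, rounded up to 2 in the result.
  have hsum := hasSum_le hshell (hasSum_shell hd (Y t))
    (((hasSum_shell hd (Y 0)).add (hasSum_shell hd (P 0))).mul_left (2 * K ^ 2))
  have : ‖Y t‖ ≤ 2 * K * (‖Y 0‖ + ‖P 0‖) := by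
    refine le_of_sq_le_sq ?_ (by positivity)
    nlinarith [mul_nonneg (sq_nonneg K) (mul_nonneg (norm_nonneg (Y 0)) (norm_nonneg (P 0))),
      mul_nonneg (sq_nonneg K) (sq_nonneg ‖Y 0‖), mul_nonneg (sq_nonneg K) (sq_nonneg ‖P 0‖)]
  rw [hK] at this
  linarith

/-- The symbol of `exp (i s |∇|)`. -/
def phase (s : ℝ) (ξ : Space d) : ℂ := Complex.exp (Complex.I * ((s * absGrad ξ : ℝ) : ℂ))

lemma norm_phase (s : ℝ) (ξ : Space d) : ‖phase s ξ‖ = 1 := by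
  rw [phase, mul_comm, Complex.norm_exp_ofReal_mul_I]

lemma measurable_phase (s : ℝ) : Measurable (phase s : Space d → ℂ) :=
  Complex.measurable_exp.comp
    ((Complex.measurable_ofReal.comp (measurable_absGrad.const_mul s)).const_mul _)

lemma isMultiplier_const_mul_phase (c : ℂ) (s : ℝ) :
    IsMultiplier (fun ξ : Space d => c * phase s ξ) :=
  ⟨(measurable_phase s).const_mul c, ‖c‖, fun ξ => by rw [norm_mul, norm_phase, mul_one]⟩

lemma isMultiplier_phase (s : ℝ) : IsMultiplier (phase s : Space d → ℂ) :=
  ⟨measurable_phase s, 1, fun ξ => (norm_phase s ξ).le⟩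

/-- The symbol `k exp (i s |∇|)`, cut off to `S`. -/
def cutoffPhase (S : Set (Space d)) (k : Space d → ℂ) (s : ℝ) (ξ : Space d) : ℂ :=
  cutoff S ξ * (k ξ * phase s ξ)

lemma isMultiplier_cutoffPhase {S : Set (Space d)} (hS : MeasurableSet S) {k : Space d → ℂ}
    (hk : Measurable k) {C : ℝ} (hC0 : 0 ≤ C) (hC : ∀ ξ ∈ S, ‖k ξ‖ ≤ C) (s : ℝ) :
    IsMultiplier (cutoffPhase S k s) :=
  (isMultiplier_cutoff_mul hS (hk.mul (measurable_phase s)) hC0 fun ξ hξ => by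
    rw [Pi.mul_apply, norm_mul, norm_phase, mul_one]; exact hC ξ hξ).1

-- Where |∇| ≤ N, the estimate |e^{ix} - 1 - ix| ≤ x² with x = σh|∇| and |h|N < 1 bounds the Taylor
-- remainder by CN²h² in operator norm. Without the cutoff the phase would only be strongly
-- continuous.
open Complex in
lemma hasDerivAt_mulL_cutoffPhase {S : Set (Space d)} (hS : MeasurableSet S) {N : ℝ} (hN0 : 0 ≤ N)
    (hN : ∀ ξ ∈ S, absGrad ξ ≤ N) {k : Space d → ℂ} (hk : Measurable k) {C : ℝ} (hC0 : 0 ≤ C)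
    (hC : ∀ ξ ∈ S, ‖k ξ‖ ≤ C) {σ : ℝ} (hσ : |σ| = 1) (t : ℝ) :
    HasDerivAt (fun t => mulL (cutoffPhase S k (σ * t)))
      (mulL (cutoffPhase S (fun ξ => I * σ * absGrad ξ * k ξ) (σ * t))) t := by
  have hm := isMultiplier_cutoffPhase hS hk hC0 hC
  have hm' : IsMultiplier (cutoffPhase S (fun ξ => I * σ * absGrad ξ * k ξ) (σ * t)) := by
    refine isMultiplier_cutoffPhase hS ((measurable_absGrad_coe.const_mul _).mul hk)
      (mul_nonneg hN0 hC0) (fun ξ hξ => ?_) _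
    rw [Pi.mul_apply, norm_mul, norm_mul, norm_mul, norm_I, norm_absGrad_coe, norm_real, Real.norm_eq_abs, hσ,
      one_mul, one_mul]
    exact mul_le_mul (hN ξ hξ) (hC ξ hξ) (norm_nonneg _) hN0
  rw [hasDerivAt_iff_isLittleO_nhds_zero]
  refine Asymptotics.IsBigO.trans_isLittleO (g := fun h : ℝ => h ^ 2) ?_
    (Asymptotics.isLittleO_pow_id one_lt_two)
  refine Asymptotics.IsBigO.of_bound (C * N ^ 2) ?_
  have hnear : ∀ᶠ h : ℝ in nhds 0, |h| * N < 1 := by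
    have : ContinuousAt (fun h : ℝ => |h| * N) 0 := by fun_prop
    exact this.eventually_lt continuousAt_const (by simp)
  filter_upwards [hnear] with h hh
  refine ContinuousLinearMap.opNorm_le_bound _ (by positivity) fun f => ?_
  rw [sub_apply, sub_apply, smul_apply]
  refine norm_le_of_ae ?_
  filter_upwards [mulL_ae (hm (σ * (t + h))) f, mulL_ae (hm (σ * t)) f, mulL_ae hm' f,
    Lp.coeFn_sub (mulL (cutoffPhase S k (σ * (t + h))) f - mulL (cutoffPhase S k (σ * t)) f)
      (h • mulL (cutoffPhase S (fun ξ => I * σ * absGrad ξ * k ξ) (σ * t)) f),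
    Lp.coeFn_sub (mulL (cutoffPhase S k (σ * (t + h))) f) (mulL (cutoffPhase S k (σ * t)) f),
    Lp.coeFn_smul h (mulL (cutoffPhase S (fun ξ => I * σ * absGrad ξ * k ξ) (σ * t)) f)]
    with ξ h1 h2 h3 h4 h5 h6
  rw [h4, Pi.sub_apply, h5, Pi.sub_apply, h6, Pi.smul_apply, h1, h2, h3]
  have hfac : cutoffPhase S k (σ * (t + h)) ξ * f ξ - cutoffPhase S k (σ * t) ξ * f ξ
      - h • (cutoffPhase S (fun ξ => I * σ * absGrad ξ * k ξ) (σ * t) ξ * f ξ)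
      = cutoff S ξ * (k ξ * phase (σ * t) ξ * (exp (I * ((σ * h * absGrad ξ : ℝ) : ℂ)) - 1
        - I * ((σ * h * absGrad ξ : ℝ) : ℂ))) * f ξ := by
    have : phase (σ * (t + h)) ξ = phase (σ * t) ξ * exp (I * ((σ * h * absGrad ξ : ℝ) : ℂ)) := by
      rw [phase, phase, ← Complex.exp_add]
      congr 1
      push_cast
      ring
    simp only [cutoffPhase, this, real_smul]
    push_cast
    ring
  rw [hfac, norm_mul]
  refine mul_le_mul_of_nonneg_right ?_ (norm_nonneg _)
  by_cases hξ : ξ ∈ S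
  · have hx : ‖I * ((σ * h * absGrad ξ : ℝ) : ℂ)‖ = |h| * absGrad ξ := by
      rw [norm_mul, norm_I, one_mul, norm_real, Real.norm_eq_abs, abs_mul, abs_mul, hσ, one_mul,
        abs_of_nonneg (absGrad_nonneg ξ)]
    have hle : |h| * absGrad ξ ≤ |h| * N := mul_le_mul_of_nonneg_left (hN ξ hξ) (abs_nonneg h)
    have he := norm_exp_sub_one_sub_id_le (hx.trans_le (hle.trans hh.le))
    rw [hx] at he
    rw [norm_mul, norm_mul, norm_mul, norm_phase, mul_one]
    have h0 : 0 ≤ |h| * absGrad ξ := mul_nonneg (abs_nonneg h) (absGrad_nonneg ξ)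
    calc _ ≤ 1 * (C * (|h| * N) ^ 2) :=
          mul_le_mul (norm_cutoff_le S ξ) (mul_le_mul (hC ξ hξ)
            (he.trans (pow_le_pow_left₀ h0 hle 2)) (norm_nonneg _) hC0)
            (mul_nonneg (norm_nonneg _) (norm_nonneg _)) zero_le_one
      _ = _ := by rw [norm_pow, Real.norm_eq_abs]; ring
  · simp only [cutoff, indicator_of_notMem hξ, zero_mul, norm_zero]
    positivity

end

/-! ### Convergence of the solution pulled back by the free flow -/

/-- A curve whose increments are dominated by those of a nonnegative function converges. -/
lemma exists_limit_of_increments {X : Type*} [NormedAddCommGroup X] [CompleteSpace X]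
    {Z : ℝ → X} {R : ℝ → ℝ} (hR : ∀ t, 0 ≤ t → 0 ≤ R t)
    (h : ∀ s t, 0 ≤ s → s ≤ t → ‖Z t - Z s‖ ≤ R s - R t) :
    ∃ z, ∀ t, 0 ≤ t → ‖Z t - z‖ ≤ R t := by
  have hanti : Antitone fun n : ℕ => R n := fun a b hab =>
    sub_nonneg.1 ((norm_nonneg _).trans (h a b a.cast_nonneg (Nat.cast_le.2 hab)))
  have hbdd : BddBelow (range fun n : ℕ => R n) :=
    ⟨0, by rintro _ ⟨n, rfl⟩; exact hR n n.cast_nonneg⟩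
  have hlim := tendsto_atTop_ciInf hanti hbdd
  have hcau : CauchySeq fun n : ℕ => Z n := by
    refine cauchySeq_of_le_tendsto_0' (fun n : ℕ => R n - ⨅ n : ℕ, R n) (fun n m hnm => ?_) ?_
    · rw [dist_comm, dist_eq_norm]
      have h1 := h n m n.cast_nonneg (Nat.cast_le.2 hnm)
      have h2 := ciInf_le hbdd m
      linarith
    · simpa using hlim.sub_const (⨅ n : ℕ, R n)
  obtain ⟨z, hz⟩ := cauchySeq_tendsto_of_complete hcau
  refine ⟨z, fun t ht => ?_⟩
  rw [norm_sub_rev]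
  refine le_of_tendsto (hz.sub_const (Z t)).norm ?_
  filter_upwards [Filter.eventually_ge_atTop ⌈t⌉₊] with n hn
  have h1 := h t n ht (Nat.ceil_le.1 hn)
  have h2 := hR n n.cast_nonneg
  linarith

section

variable {d : ℕ} {μ : ℝ} {Y P B : ℝ → L2 d}

open Complex

/-- `exp (iσt|∇|) (P - iσB)`: a component of the solution pulled back by the free wave flow. -/
def pullback (P B : ℝ → L2 d) (σ t : ℝ) : L2 d :=
  mulL (phase (σ * t)) (P t) + mulL (fun ξ => (-(I * σ)) * phase (σ * t) ξ) (B t)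

lemma norm_neg_I_mul {σ : ℝ} (hσ : |σ| = 1) : ‖-(I * (σ : ℂ))‖ = 1 := by
  rw [norm_neg, norm_mul, norm_I, norm_real, Real.norm_eq_abs, hσ, one_mul]

/-- Multiplication by `exp (i s |∇|)`, cut off to `S`. -/
abbrev phaseL (S : Set (Space d)) (s : ℝ) : L2 d →L[ℝ] L2 d := mulL (cutoffPhase S (fun _ => 1) s)

/-- Multiplication by `c |∇| exp (i s |∇|)`, cut off to `S`. -/
abbrev gradPhaseL (S : Set (Space d)) (c : ℂ) (s : ℝ) : L2 d →L[ℝ] L2 d :=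
  mulL (cutoffPhase S (fun ξ => c * absGrad ξ) s)

lemma isMultiplier_phaseL {S : Set (Space d)} (hS : MeasurableSet S) (s : ℝ) : IsMultiplier (cutoffPhase S (fun _ => 1) s) :=
  isMultiplier_cutoffPhase hS measurable_const zero_le_one (fun ξ _ => by simp) s

lemma isMultiplier_gradPhaseL {S : Set (Space d)} (hS : MeasurableSet S) {N : ℝ} (hN0 : 0 ≤ N)
    (hN : ∀ ξ ∈ S, absGrad ξ ≤ N) (c : ℂ) (s : ℝ) :
    IsMultiplier (cutoffPhase S (fun ξ => c * absGrad ξ) s) :=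
  isMultiplier_cutoffPhase hS (measurable_absGrad_coe.const_mul c)
    (mul_nonneg (norm_nonneg c) hN0) (fun ξ hξ => by
      rw [norm_mul, norm_absGrad_coe]
      exact mul_le_mul_of_nonneg_left (hN ξ hξ) (norm_nonneg c)) s

lemma hasDerivAt_phaseL {S : Set (Space d)} (hS : MeasurableSet S) {N : ℝ} (hN0 : 0 ≤ N)
    (hN : ∀ ξ ∈ S, absGrad ξ ≤ N) {σ : ℝ} (hσ : |σ| = 1) (t : ℝ) :
    HasDerivAt (fun t => phaseL S (σ * t)) (gradPhaseL S (I * σ) (σ * t)) t := by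
  simpa only [mul_one] using hasDerivAt_mulL_cutoffPhase hS hN0 hN measurable_const zero_le_one
    (k := fun _ => 1) (fun ξ _ => by simp) hσ t

/-- The factor is iσ·(-iσ) = σ² = 1, so this term cancels the -|∇|²Y in the derivative of P. -/
lemma hasDerivAt_gradPhaseL {S : Set (Space d)} (hS : MeasurableSet S) {N : ℝ} (hN0 : 0 ≤ N)
    (hN : ∀ ξ ∈ S, absGrad ξ ≤ N) {σ : ℝ} (hσ : |σ| = 1) (t : ℝ) :
    HasDerivAt (fun t => gradPhaseL S (-(I * σ)) (σ * t))
      (mulL (cutoffPhase S (fun ξ => (absGrad ξ : ℂ) ^ 2) (σ * t))) t := by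
  have hσ2 : (σ : ℂ) * σ = 1 := by
    rw [← ofReal_mul, ← abs_mul_abs_self, hσ, one_mul, ofReal_one]
  have h := hasDerivAt_mulL_cutoffPhase hS hN0 hN
    (measurable_absGrad_coe.const_mul (-(I * (σ : ℂ)))) hN0 (fun ξ hξ => by
      rw [norm_mul, norm_neg_I_mul hσ, one_mul, norm_absGrad_coe]; exact hN ξ hξ) hσ t
  have e : (fun ξ : Space d => I * σ * absGrad ξ * (-(I * (σ : ℂ)) * absGrad ξ))
      = fun ξ => (absGrad ξ : ℂ) ^ 2 := by
    funext ξ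
    linear_combination (-(absGrad ξ : ℂ) ^ 2) * (σ * σ * I_mul_I - hσ2)
  rwa [e] at h

lemma gradPhaseL_neg {S : Set (Space d)} (hS : MeasurableSet S) {N : ℝ} (hN0 : 0 ≤ N)
    (hN : ∀ ξ ∈ S, absGrad ξ ≤ N) (c : ℂ) (s : ℝ) (f : L2 d) :
    gradPhaseL S (-c) s f = -gradPhaseL S c s f := by
  refine Lp.ext ?_
  filter_upwards [mulL_ae (isMultiplier_gradPhaseL hS hN0 hN (-c) s) f,
    mulL_ae (isMultiplier_gradPhaseL hS hN0 hN c s) f, Lp.coeFn_neg (gradPhaseL S c s f)]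
    with ξ h1 h2 h3
  rw [h1, h3, Pi.neg_apply, h2, cutoffPhase, cutoffPhase]
  ring

lemma phaseL_gradL_gradL {S : Set (Space d)} (hS : MeasurableSet S) {N : ℝ} (hN0 : 0 ≤ N)
    (hN : ∀ ξ ∈ S, absGrad ξ ≤ N) (s : ℝ) (f : L2 d) :
    phaseL S s (gradL S (gradL S f)) = mulL (cutoffPhase S (fun ξ => (absGrad ξ : ℂ) ^ 2) s) f := by
  have hm := (isMultiplier_grad hS hN0 hN).1
  have hm2 : IsMultiplier (cutoffPhase S (fun ξ => (absGrad ξ : ℂ) ^ 2) s) :=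
    isMultiplier_cutoffPhase hS (measurable_absGrad_coe.pow_const 2) (sq_nonneg N) (fun ξ hξ => by
      rw [norm_pow, norm_absGrad_coe]
      exact pow_le_pow_left₀ (absGrad_nonneg ξ) (hN ξ hξ) 2) s
  refine Lp.ext ?_
  filter_upwards [mulL_ae (isMultiplier_phaseL hS s) (gradL S (gradL S f)), mulL_ae hm (gradL S f),
    mulL_ae hm f, mulL_ae hm2 f] with ξ h1 h2 h3 h4
  rw [h1, h2, h3, h4, cutoffPhase, cutoffPhase]
  linear_combination
    (phase s ξ * absGrad ξ ^ 2 * f ξ) * ((cutoff S ξ + 1) * cutoff_mul_self S ξ)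

namespace IsSpectralSolution

lemma cutoff_pullback (h : IsSpectralSolution μ Y P B) {S : Set (Space d)}
    (hS : MeasurableSet S) {N : ℝ} (hN0 : 0 ≤ N) (hN : ∀ ξ ∈ S, absGrad ξ ≤ N) (σ : ℝ) {t : ℝ}
    (ht : 0 ≤ t) :
    mulL (cutoff S) (pullback P B σ t) = phaseL S (σ * t) (mulL (cutoff S) (P t))
      + gradPhaseL S (-(I * σ)) (σ * t) (mulL (cutoff S) (Y t)) := by
  have hc := isMultiplier_cutoff hS
  rw [pullback, map_add]
  refine congrArg₂ (fun u v => u + v) (Lp.ext ?_) (Lp.ext ?_)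
  · filter_upwards [mulL_ae (isMultiplier_phaseL hS (σ * t)) (mulL (cutoff S) (P t)),
      mulL_ae hc (P t), mulL_ae hc (mulL (phase (σ * t)) (P t)),
      mulL_ae (isMultiplier_phase (σ * t)) (P t)] with ξ h1 h2 h3 h4
    rw [h1, h2, h3, h4, cutoffPhase]
    linear_combination (-phase (σ * t) ξ * P t ξ) * cutoff_mul_self S ξ
  · filter_upwards [mulL_ae (isMultiplier_gradPhaseL hS hN0 hN (-(I * σ)) (σ * t))
      (mulL (cutoff S) (Y t)), mulL_ae hc (Y t),
      mulL_ae hc (mulL (fun ξ => (-(I * σ)) * phase (σ * t) ξ) (B t)),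
      mulL_ae (isMultiplier_const_mul_phase (-(I * σ)) (σ * t)) (B t), h.grad t ht]
      with ξ h1 h2 h3 h4 h5
    rw [h1, h2, h3, h4, h5, cutoffPhase]
    linear_combination (I * σ * absGrad ξ * phase (σ * t) ξ * Y t ξ) * cutoff_mul_self S ξ

/-- The derivative of the pullback, cut off to bounded frequencies. -/
lemma hasDerivAt_cutoff_pullback (h : IsSpectralSolution μ Y P B) {S : Set (Space d)}
    (hS : MeasurableSet S) {N : ℝ} (hN0 : 0 ≤ N) (hN : ∀ ξ ∈ S, absGrad ξ ≤ N) {σ : ℝ}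
    (hσ : |σ| = 1) :
    ∃ Z : ℝ → L2 d, ContinuousOn Z (Ici 0) ∧
      (∀ t, 0 ≤ t → Z t = mulL (cutoff S) (pullback P B σ t)) ∧
      ∀ t, 0 < t → ∃ D, HasDerivAt Z D t ∧ ‖D‖ ≤ |μ / (1 + t) ^ 2| * ‖Y t‖ := by
  have ho := h.isOscillator hS hN0 hN
  have hE := hasDerivAt_phaseL hS hN0 hN hσ
  have hF := hasDerivAt_gradPhaseL hS hN0 hN hσ
  refine ⟨fun t => phaseL S (σ * t) (mulL (cutoff S) (P t))
      + gradPhaseL S (-(I * σ)) (σ * t) (mulL (cutoff S) (Y t)), ?_,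
    fun t ht => (h.cutoff_pullback hS hN0 hN σ ht).symm, fun t ht => ?_⟩
  · exact (ContinuousOn.clm_apply (fun t _ => (hE t).continuousAt.continuousWithinAt)
      ho.cont_deriv).add (ContinuousOn.clm_apply
        (fun t _ => (hF t).continuousAt.continuousWithinAt) ho.cont)
  · refine ⟨_, ((hE t).clm_apply (ho.deriv2 t ht)).add ((hF t).clm_apply (ho.deriv t ht)), ?_⟩
    rw [map_sub, map_neg, map_smul, phaseL_gradL_gradL hS hN0 hN, gradPhaseL_neg hS hN0 hN]
    generalize mulL (cutoffPhase S (fun ξ => (absGrad ξ : ℂ) ^ 2) (σ * t)) = G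
    -- Here a is the first-order term in P, c the term in |∇|²Y and b the potential term. The free
    -- evolution cancels and only b survives.
    have e : ∀ a b c : L2 d, a + (-b - c) + (c + -a) = -b := fun a b c => by abel
    rw [e, norm_neg, norm_smul, Real.norm_eq_abs]
    refine mul_le_mul_of_nonneg_left ?_ (abs_nonneg _)
    refine (norm_mulL_le (isMultiplier_phaseL hS (σ * t)) (C := 1) (fun ξ => ?_) _).trans ?_
    · rw [cutoffPhase, one_mul, norm_mul, norm_phase, mul_one]
      exact norm_cutoff_le S ξ
    · have := norm_mulL_le (isMultiplier_cutoff hS) (norm_cutoff_le S) (Y t)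
      linarith

/-- The pullback converges, at the rate of the primitive `R` of `-μ/(1+t)² ‖Y‖`. -/
lemma exists_limit_pullback (h : IsSpectralSolution μ Y P B) {R : ℝ → ℝ} {R' : ℝ → ℝ}
    (hR0 : ∀ t, 0 ≤ t → 0 ≤ R t) (hR : ∀ t, 0 ≤ t → HasDerivAt R (-R' t) t)
    (hR' : ∀ t, 0 ≤ t → |μ / (1 + t) ^ 2| * ‖Y t‖ ≤ R' t) {σ : ℝ} (hσ : |σ| = 1) :
    ∃ z, ∀ t, 0 ≤ t → ‖pullback P B σ t - z‖ ≤ R t := by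
  refine exists_limit_of_increments hR0 fun s t hs hst => ?_
  have hRc : ContinuousOn R (Ici 0) := fun t ht => (hR t ht).continuousAt.continuousWithinAt
  have hmain : ∀ N : ℕ, ‖mulL (cutoff (freqBall d N)) (pullback P B σ t - pullback P B σ s)‖
      ≤ R s - R t := by
    intro N
    obtain ⟨Z, hZc, hZ, hZd⟩ := h.hasDerivAt_cutoff_pullback (measurableSet_freqBall N)
      N.cast_nonneg (fun ξ hξ => hξ) hσ
    rw [map_sub, ← hZ t (hs.trans hst), ← hZ s hs]
    -- The derivative is known at positive times only; s = 0 is recovered afterwards by continuity.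
    have hpos : ∀ s, 0 < s → s ≤ t → ‖Z t - Z s‖ ≤ R s - R t := by
      intro s hs hst
      choose! D hD hDn using hZd
      refine image_norm_le_of_norm_deriv_right_le_deriv_boundary' (f := fun x => Z x - Z s)
        (f' := D) (B := fun x => R s - R x) (B' := R') (a := s) (b := t) ?_ ?_ ?_ ?_ ?_ ?_
        (right_mem_Icc.2 hst)
      · exact (hZc.mono fun x hx => hs.le.trans hx.1).sub continuousOn_const
      · exact fun x hx => ((hD x (hs.trans_le hx.1)).sub_const _).hasDerivWithinAt
      · simp
      · exact continuousOn_const.sub (hRc.mono fun x hx => hs.le.trans hx.1)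
      · intro x hx
        simpa using ((hR x (hs.le.trans hx.1)).const_sub (R s)).hasDerivWithinAt
      · exact fun x hx => (hDn x (hs.trans_le hx.1)).trans (hR' x (hs.le.trans hx.1))
    rcases hs.lt_or_eq with hs | rfl
    · exact hpos s hs hst
    rcases hst.lt_or_eq with ht | rfl
    · have hmem : (0 : ℝ) ∈ closure (Ioc 0 t) := by
        rw [closure_Ioc ht.ne]
        exact left_mem_Icc.2 ht.le
      have hsub : Ioc 0 t ⊆ Ici (0 : ℝ) := fun x hx => hx.1.le
      exact ContinuousWithinAt.closure_le (f := fun s => ‖Z t - Z s‖) (g := fun s => R s - R t) hmem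
        (continuousWithinAt_const.sub ((hZc 0 self_mem_Ici).mono hsub)).norm
        (((hRc 0 self_mem_Ici).mono hsub).sub continuousWithinAt_const)
        fun x hx => hpos x hx.1 hx.2
    · simp
  exact norm_le_of_freqBall ((norm_nonneg _).trans (hmain 0)) hmain

end IsSpectralSolution

end

/-! ### The isometry |∇| : Ḣ¹ → L² and the equation on the Fourier side -/

section

variable {d : ℕ}

/-- The weight vanishes only where |∇| = 0, so identities in Ḣ¹ hold Lebesgue almost everywhere
after multiplication by |∇|. -/
lemma ae_gradMeasure_iff {p : Space d → Prop} :
    (∀ᵐ ξ ∂gradMeasure d, p ξ) ↔ ∀ᵐ ξ, absGrad ξ ≠ 0 → p ξ := by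
  rw [gradMeasure, ae_withDensity_iff (measurable_absGrad.pow_const 2).ennreal_ofReal]
  refine Filter.eventually_congr (Filter.Eventually.of_forall fun ξ => ?_)
  rw [ne_eq, ENNReal.ofReal_eq_zero, not_le, sq_pos_iff]

lemma integral_gradMeasure (f : Space d → ℝ) :
    ∫ ξ, f ξ ∂gradMeasure d = ∫ ξ, absGrad ξ ^ 2 * f ξ := by
  rw [gradMeasure, integral_withDensity_eq_integral_toReal_smul
    (measurable_absGrad.pow_const 2).ennreal_ofReal
    (Filter.Eventually.of_forall fun _ => ENNReal.ofReal_lt_top)]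
  simp_rw [ENNReal.toReal_ofReal (sq_nonneg _), smul_eq_mul]

lemma memLp_gradLp (F : HDot1 d) : MemLp (fun ξ => (absGrad ξ : ℂ) * F ξ) 2 volume :=
  (memLp_gradMeasure_iff (Lp.stronglyMeasurable F).aestronglyMeasurable).1 (Lp.memLp F)

/-- The isometry `|∇| : Ḣ¹ → L²`, on the Fourier side. -/
def gradLI (d : ℕ) : HDot1 d →ₗᵢ[ℝ] L2 d where
  toFun F := (memLp_gradLp F).toLp
  map_add' F G := by
    rw [← MemLp.toLp_add, MemLp.toLp_eq_toLp_iff]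
    filter_upwards [ae_gradMeasure_iff.1 (Lp.coeFn_add F G)] with ξ h
    by_cases h0 : absGrad ξ = 0
    · simp [h0]
    · simp only [h h0, Pi.add_apply, mul_add]
  map_smul' c F := by
    rw [RingHom.id_apply, ← MemLp.toLp_const_smul, MemLp.toLp_eq_toLp_iff]
    filter_upwards [ae_gradMeasure_iff.1 (Lp.coeFn_smul c F)] with ξ h
    by_cases h0 : absGrad ξ = 0
    · simp [h0]
    · simp only [h h0, Pi.smul_apply, Complex.real_smul]
      ring
  norm_map' F := by
    simp only [LinearMap.coe_mk, AddHom.coe_mk]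
    rw [← sq_eq_sq₀ (norm_nonneg _) (norm_nonneg _), norm_sq_eq_integral,
      ← real_inner_self_eq_norm_sq, L2.inner_def]
    simp_rw [real_inner_self_eq_norm_sq]
    rw [integral_gradMeasure]
    refine integral_congr_ae ?_
    filter_upwards [(memLp_gradLp F).coeFn_toLp] with ξ h
    rw [h, norm_mul, norm_absGrad_coe, mul_pow]

lemma gradLI_ae (F : HDot1 d) : gradLI d F =ᵐ[volume] fun ξ => (absGrad ξ : ℂ) * F ξ :=
  (memLp_gradLp F).coeFn_toLp

/-- `gradLI F`, for `F` given almost everywhere in the weighted sense. -/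
lemma gradLI_ae_of_ae {F : HDot1 d} {f : Space d → ℂ} (h : F =ᵐ[gradMeasure d] f) :
    gradLI d F =ᵐ[volume] fun ξ => (absGrad ξ : ℂ) * f ξ := by
  filter_upwards [gradLI_ae F, ae_gradMeasure_iff.1 h] with ξ h1 h2
  rw [h1]
  by_cases h0 : absGrad ξ = 0
  · simp [h0]
  · rw [h2 h0]

lemma gradLI_toHDot1 (f : H1 d) :
    gradLI d (toHDot1 f) =ᵐ[volume] fun ξ => (absGrad ξ : ℂ) * (𝓕 (f : L2 d) : L2 d) ξ :=
  gradLI_ae_of_ae (MemLp.coeFn_toLp _)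

/-- Division by |∇| is harmless off the null set {0}. This turns an L² limit into a datum in Ḣ¹. -/
lemma exists_gradLI_eq (hd : 1 ≤ d) (g : L2 d) : ∃ F : HDot1 d, gradLI d F = g := by
  have hm : AEStronglyMeasurable (fun ξ => ((absGrad ξ)⁻¹ : ℂ) * g ξ) volume :=
    (measurable_absGrad_coe.inv.aestronglyMeasurable).mul (Lp.memLp g).1
  have hF : MemLp (fun ξ => ((absGrad ξ)⁻¹ : ℂ) * g ξ) 2 (gradMeasure d) := by
    refine (memLp_gradMeasure_iff hm).2 ((memLp_congr_ae ?_).1 (Lp.memLp g))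
    filter_upwards [ae_absGrad_pos hd] with ξ hξ
    rw [mul_inv_cancel_left₀ (Complex.ofReal_ne_zero.2 hξ.ne')]
  refine ⟨hF.toLp, Lp.ext ?_⟩
  filter_upwards [gradLI_ae_of_ae hF.coeFn_toLp, ae_absGrad_pos hd] with ξ h hξ
  rw [h, mul_inv_cancel_left₀ (Complex.ofReal_ne_zero.2 hξ.ne')]

/-- The Fourier transform on `L²`, as a real linear map. -/
def fourierL (d : ℕ) : L2 d →L[ℝ] L2 d :=
  (Lp.fourierTransformₗᵢ (Space d) ℂ).toContinuousLinearEquiv.toContinuousLinearMap.restrictScalars ℝ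

lemma fourierL_apply (f : L2 d) : fourierL d f = 𝓕 f := rfl

/-- The bilinear pairing `f ↦ ∫ w f` on `L²`. -/
def pairL (w : L2 d) : L2 d →L[ℝ] ℂ :=
  ((ContinuousLinearMap.mul ℂ ℂ).lpPairing volume 2 2 w).restrictScalars ℝ

lemma pairL_apply (w f : L2 d) : pairL w f = ∫ ξ, w ξ * f ξ := by
  simp [pairL, ContinuousLinearMap.lpPairing_eq_integral]

lemma toTemperedDistribution_fourier (f : L2 d) (ψ : 𝓢(Space d, ℂ)) :
    (f : 𝓢'(Space d, ℂ)) (𝓕 ψ) = ∫ ξ, ψ ξ * (𝓕 f : L2 d) ξ := by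
  rw [← TemperedDistribution.fourier_apply, Lp.fourier_toTemperedDistribution_eq,
    Lp.toTemperedDistribution_apply]
  rfl

/-- Testing against 𝓕 ψ moves the pairing to frequency space, where ψ can later be chosen with
compact support. -/
lemma laplacian_fourier (f : L2 d) (ψ : 𝓢(Space d, ℂ)) :
    (Δ (f : 𝓢'(Space d, ℂ))) (𝓕 ψ) = -∫ ξ, (absGrad ξ : ℂ) ^ 2 * ψ ξ * (𝓕 f : L2 d) ξ := by
  have hg : (fun x : Space d => Complex.ofReal (‖x‖ ^ 2)).HasTemperateGrowth := by fun_prop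
  rw [TemperedDistribution.laplacian_eq_fourierMultiplierCLM]
  have e : (-(2 * Real.pi) ^ 2 • TemperedDistribution.fourierMultiplierCLM ℂ
      (fun x : Space d => Complex.ofReal (‖x‖ ^ 2)) (f : 𝓢'(Space d, ℂ))) (𝓕 ψ)
      = -(2 * Real.pi) ^ 2 • (TemperedDistribution.fourierMultiplierCLM ℂ
      (fun x : Space d => Complex.ofReal (‖x‖ ^ 2)) (f : 𝓢'(Space d, ℂ))) (𝓕 ψ) := rfl
  rw [e, TemperedDistribution.fourierMultiplierCLM_apply_apply,
    FourierTransform.fourierInv_fourier_eq, toTemperedDistribution_fourier, ← integral_smul,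
    ← integral_neg]
  refine integral_congr_ae (Filter.Eventually.of_forall fun ξ => ?_)
  simp only [SchwartzMap.smulLeftCLM_apply_apply hg, absGrad, Complex.real_smul, smul_eq_mul]
  push_cast
  ring

end

/-! ### The Liouville transform of a distributional solution -/

section

variable {d : ℕ} {μ₁ μ₂ : ℝ} {u₀ : H1 d} {u₁ : L2 d} {u : ℝ → H1 d} {u' : ℝ → L2 d}

/-- The Fourier transform of the Liouville transform `(1+t)^(μ₁/2) u`. -/
def spectralY (μ₁ : ℝ) (u : ℝ → H1 d) (t : ℝ) : L2 d :=
  (1 + t) ^ (μ₁ / 2) • fourierL d (u t : L2 d)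

/-- The time derivative of `spectralY`. -/
def spectralP (μ₁ : ℝ) (u : ℝ → H1 d) (u' : ℝ → L2 d) (t : ℝ) : L2 d :=
  (1 + t) ^ (μ₁ / 2) • (fourierL d (u' t) + (μ₁ / 2 / (1 + t)) • fourierL d (u t : L2 d))

/-- `|∇|` applied to `spectralY`. -/
def spectralB (μ₁ : ℝ) (u : ℝ → H1 d) (t : ℝ) : L2 d :=
  (1 + t) ^ (μ₁ / 2) • gradLI d (toHDot1 (u t))

lemma hasDerivAt_liouville (μ₁ : ℝ) {t : ℝ} (ht : 0 ≤ t) :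
    HasDerivAt (fun t : ℝ => (1 + t) ^ (μ₁ / 2)) ((1 + t) ^ (μ₁ / 2) * (μ₁ / 2 / (1 + t))) t := by
  have h1 : 1 + t ≠ 0 := by positivity
  refine (hasDerivAt_one_add_rpow (μ₁ / 2) ht).congr_deriv ?_
  rw [Real.rpow_sub_one h1]
  ring

lemma continuousOn_liouville (μ₁ : ℝ) : ContinuousOn (fun t : ℝ => (1 + t) ^ (μ₁ / 2)) (Ici 0) :=
  fun _ ht => (hasDerivAt_liouville μ₁ ht).continuousAt.continuousWithinAt

lemma hasDerivAt_damping (μ₁ : ℝ) {t : ℝ} (ht : 0 ≤ t) :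
    HasDerivAt (fun t : ℝ => μ₁ / 2 / (1 + t)) (-(μ₁ / 2 / (1 + t) ^ 2)) t := by
  have h1 : 1 + t ≠ 0 := by positivity
  refine ((hasDerivAt_const t (μ₁ / 2)).div ((hasDerivAt_id t).const_add 1) h1).congr_deriv ?_
  simp only [id]
  ring

namespace IsSolution

lemma continuousOn_spectralY (h : IsSolution μ₁ μ₂ u₀ u₁ u u') :
    ContinuousOn (spectralY μ₁ u) (Ici 0) :=
  (continuousOn_liouville μ₁).smul ((fourierL d).continuous.comp_continuousOn h.continuousOn_L2)

lemma continuousOn_spectralP (h : IsSolution μ₁ μ₂ u₀ u₁ u u') :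
    ContinuousOn (spectralP μ₁ u u') (Ici 0) :=
  (continuousOn_liouville μ₁).smul
    (((fourierL d).continuous.comp_continuousOn h.continuousOn_deriv).add
      (ContinuousOn.smul
        (fun _ ht => (hasDerivAt_damping μ₁ ht).continuousAt.continuousWithinAt)
        ((fourierL d).continuous.comp_continuousOn h.continuousOn_L2)))

lemma continuousOn_spectralB (h : IsSolution μ₁ μ₂ u₀ u₁ u u') :
    ContinuousOn (spectralB μ₁ u) (Ici 0) :=
  (continuousOn_liouville μ₁).smul ((gradLI d).continuous.comp_continuousOn h.continuousOn_HDot1)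

lemma hasDerivAt_fourierL (h : IsSolution μ₁ μ₂ u₀ u₁ u u') {t : ℝ} (ht : 0 < t) :
    HasDerivAt (fun t => fourierL d (u t : L2 d)) (fourierL d (u' t)) t :=
  (fourierL d).hasFDerivAt.comp_hasDerivAt t
    ((h.hasDeriv t ht.le).hasDerivAt (Ici_mem_nhds ht))

lemma hasDerivAt_spectralY (h : IsSolution μ₁ μ₂ u₀ u₁ u u') {t : ℝ} (ht : 0 < t) :
    HasDerivAt (spectralY μ₁ u) (spectralP μ₁ u u' t) t := by
  refine ((hasDerivAt_liouville μ₁ ht.le).smul (h.hasDerivAt_fourierL ht)).congr_deriv ?_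
  rw [spectralP, smul_add, smul_smul]

lemma spectralB_ae (t : ℝ) :
    spectralB μ₁ u t =ᵐ[volume] fun ξ => (absGrad ξ : ℂ) * spectralY μ₁ u t ξ := by
  filter_upwards [gradLI_toHDot1 (u t), Lp.coeFn_smul ((1 + t) ^ (μ₁ / 2)) (gradLI d (toHDot1 (u t))),
    Lp.coeFn_smul ((1 + t) ^ (μ₁ / 2)) (fourierL d (u t : L2 d))] with ξ h1 h2 h3
  rw [spectralB, spectralY, h2, h3, Pi.smul_apply, Pi.smul_apply, h1, fourierL_apply,
    Complex.real_smul, Complex.real_smul]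
  ring

/-- The equation tested against a Schwartz function of the frequency. -/
lemma hasDerivAt_pair_fourier (h : IsSolution μ₁ μ₂ u₀ u₁ u u') (ψ : 𝓢(Space d, ℂ)) {t : ℝ}
    (ht : 0 < t) :
    HasDerivAt (fun s => ∫ ξ, ψ ξ * fourierL d (u' s) ξ)
      (-(∫ ξ, (absGrad ξ : ℂ) ^ 2 * ψ ξ * fourierL d (u t : L2 d) ξ)
        - (μ₁ / (1 + t)) • (∫ ξ, ψ ξ * fourierL d (u' t) ξ)
        - (μ₂ / (1 + t) ^ 2) • ∫ ξ, ψ ξ * fourierL d (u t : L2 d) ξ) t := by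
  have key := h.equation (𝓕 ψ) t ht
  simp only [toTemperedDistribution_fourier, laplacian_fourier] at key
  simpa only [fourierL_apply, Complex.real_smul] using key

/-- The Liouville-transformed equation tested against a Schwartz function of the frequency. -/
lemma hasDerivAt_pair_spectralP (h : IsSolution μ₁ μ₂ u₀ u₁ u u') {ψ : 𝓢(Space d, ℂ)}
    {w₀ w₁ : L2 d} (hw₀ : w₀ =ᵐ[volume] ψ) (hw₁ : w₁ =ᵐ[volume] fun ξ => (absGrad ξ : ℂ) * ψ ξ)
    {t : ℝ} (ht : 0 < t) :
    HasDerivAt (fun s => pairL w₀ (spectralP μ₁ u u' s))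
      (-(pairL w₀ ((mass μ₁ μ₂ / (1 + t) ^ 2) • spectralY μ₁ u t)
        + pairL w₁ (spectralB μ₁ u t))) t := by
  have hp : ∀ f : L2 d, ∫ ξ, ψ ξ * f ξ = pairL w₀ f := fun f => by
    rw [pairL_apply]
    refine integral_congr_ae ?_
    filter_upwards [hw₀] with ξ h0
    rw [h0]
  have hB : pairL w₁ (spectralB μ₁ u t) = (1 + t) ^ (μ₁ / 2) •
      ∫ ξ, (absGrad ξ : ℂ) ^ 2 * ψ ξ * fourierL d (u t : L2 d) ξ := by
    rw [spectralB, map_smul, pairL_apply]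
    congr 1
    refine integral_congr_ae ?_
    filter_upwards [hw₁, gradLI_toHDot1 (u t)] with ξ h1 h2
    rw [h1, h2, fourierL_apply]
    ring
  have h1 := h.hasDerivAt_pair_fourier ψ ht
  simp only [hp] at h1
  have h2 : HasDerivAt (fun s => pairL w₀ (fourierL d (u s : L2 d)))
      (pairL w₀ (fourierL d (u' t))) t :=
    (pairL w₀).hasFDerivAt.comp_hasDerivAt t (h.hasDerivAt_fourierL ht)
  have h3 := (hasDerivAt_liouville μ₁ ht.le).smul
    (h1.add ((hasDerivAt_damping μ₁ ht.le).smul h2))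
  have e : (fun s => pairL w₀ (spectralP μ₁ u u' s)) = fun s => (1 + s) ^ (μ₁ / 2) •
      (pairL w₀ (fourierL d (u' s)) + (μ₁ / 2 / (1 + s)) • pairL w₀ (fourierL d (u s : L2 d))) := by
    funext s
    rw [spectralP, map_smul, map_add, map_smul]
  rw [e]
  -- The first-order terms cancel. With m = μ₁/2 the terms of order zero add up to m - m² + μ₂,
  -- which is the mass.
  refine h3.congr_deriv ?_
  rw [hB, spectralY, map_smul, map_smul]
  simp only [Complex.real_smul, Pi.add_apply, Pi.smul_apply', mass]
  have ht1 : ((1 + t : ℝ) : ℂ) ≠ 0 := Complex.ofReal_ne_zero.2 (by positivity)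
  generalize ∫ ξ, (absGrad ξ : ℂ) ^ 2 * ψ ξ * fourierL d (u t : L2 d) ξ = c
  generalize pairL w₀ (fourierL d (u' t)) = b
  generalize pairL w₀ (fourierL d (u t : L2 d)) = a
  generalize (1 + t) ^ (μ₁ / 2) = g
  push_cast at ht1 ⊢
  field_simp
  ring

/-- The Fourier transform of the Liouville transform of a solution is a spectral solution. -/
theorem isSpectralSolution (h : IsSolution μ₁ μ₂ u₀ u₁ u u') :
    IsSpectralSolution (mass μ₁ μ₂) (spectralY μ₁ u) (spectralP μ₁ u u') (spectralB μ₁ u) := by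
  refine ⟨h.continuousOn_spectralY, h.continuousOn_spectralP, h.continuousOn_spectralB,
    fun t ht => h.hasDerivAt_spectralY ht, fun t _ => spectralB_ae t, fun t ht => ?_⟩
  have hsub : Icc 0 t ⊆ Ici (0 : ℝ) := Icc_subset_Ici_self
  have hV : ContinuousOn (fun τ => (mass μ₁ μ₂ / (1 + τ) ^ 2) • spectralY μ₁ u τ) (Ici 0) := by
    refine ContinuousOn.smul (f := fun τ : ℝ => mass μ₁ μ₂ / (1 + τ) ^ 2)
      (ContinuousOn.div (by fun_prop) (by fun_prop) fun t ht => ?_) h.continuousOn_spectralY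
    have : 0 ≤ t := ht
    positivity
  have hint : ∀ {X : Type} [NormedAddCommGroup X] {f : ℝ → X}, ContinuousOn f (Ici 0) →
      IntervalIntegrable f volume 0 t := fun hf =>
    (hf.mono (by rw [uIcc_of_le ht]; exact hsub)).intervalIntegrable
  set X : L2 d := spectralP μ₁ u u' t - spectralP μ₁ u u' 0
    + ∫ τ in (0 : ℝ)..t, (mass μ₁ μ₂ / (1 + τ) ^ 2) • spectralY μ₁ u τ with hX
  set Z : L2 d := ∫ τ in (0 : ℝ)..t, spectralB μ₁ u τ with hZ
  have hXloc : LocallyIntegrable X volume := (Lp.memLp X).locallyIntegrable one_le_two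
  -- The product |∇|Z is not known to be in L², but local integrability suffices for the fundamental
  -- lemma of the calculus of variations.
  have hZloc : LocallyIntegrable (fun ξ => (absGrad ξ : ℂ) * Z ξ) volume := by
    have hc : Continuous fun ξ : Space d => (absGrad ξ : ℂ) :=
      Complex.continuous_ofReal.comp continuous_absGrad
    simpa only [smul_eq_mul, Pi.smul_apply'] using
      ((Lp.memLp Z).locallyIntegrable one_le_two).continuous_smul hc
  have hzero : ∀ᵐ ξ, X ξ + (absGrad ξ : ℂ) * Z ξ = 0 := by
    refine ae_eq_zero_of_integral_contDiff_smul_eq_zero (hXloc.add hZloc) fun g hg hgc => ?_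
    have hgc' : HasCompactSupport fun ξ => (g ξ : ℂ) := hgc.comp_left Complex.ofReal_zero
    set ψ : 𝓢(Space d, ℂ) := hgc'.toSchwartzMap (Complex.ofRealCLM.contDiff.comp hg) with hψ
    have hψg : ∀ ξ, ψ ξ = g ξ := fun ξ => rfl
    have hgcont : Continuous fun ξ => (g ξ : ℂ) := Complex.continuous_ofReal.comp hg.continuous
    have hm₀ : MemLp (fun ξ => (g ξ : ℂ)) 2 volume := hgcont.memLp_of_hasCompactSupport hgc'
    have hm₁ : MemLp (fun ξ => (absGrad ξ : ℂ) * (g ξ : ℂ)) 2 volume :=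
      ((Complex.continuous_ofReal.comp continuous_absGrad).mul hgcont).memLp_of_hasCompactSupport
        hgc'.mul_left
    set w₀ : L2 d := hm₀.toLp
    set w₁ : L2 d := hm₁.toLp
    have hw₀ : w₀ =ᵐ[volume] ψ := hm₀.coeFn_toLp
    have hw₁ : w₁ =ᵐ[volume] fun ξ => (absGrad ξ : ℂ) * ψ ξ := hm₁.coeFn_toLp
    have i1 : IntervalIntegrable (fun τ => pairL w₀ ((mass μ₁ μ₂ / (1 + τ) ^ 2) • spectralY μ₁ u τ))
        volume 0 t := hint ((pairL w₀).continuous.comp_continuousOn hV)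
    have i2 : IntervalIntegrable (fun τ => pairL w₁ (spectralB μ₁ u τ)) volume 0 t := hint ((pairL w₁).continuous.comp_continuousOn h.continuousOn_spectralB)
    -- The tested equation is scalar, so it can be integrated in time; the continuous pairings then
    -- commute with the L² valued integrals.
    have hftc := intervalIntegral.integral_eq_sub_of_hasDerivAt_of_le ht
      (((pairL w₀).continuous.comp_continuousOn h.continuousOn_spectralP).mono hsub)
      (fun s hs => h.hasDerivAt_pair_spectralP hw₀ hw₁ hs.1) (i1.add i2).neg
    rw [intervalIntegral.integral_neg, intervalIntegral.integral_add i1 i2,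
      ContinuousLinearMap.intervalIntegral_comp_comm _ (hint hV),
      ContinuousLinearMap.intervalIntegral_comp_comm _ (hint h.continuousOn_spectralB)] at hftc
    have hpair : pairL w₀ X + pairL w₁ Z = 0 := by
      rw [hX, map_add, map_sub]
      simp only [Function.comp_apply] at hftc
      rw [← hftc]
      ring
    rw [pairL_apply, pairL_apply, ← integral_add] at hpair
    · rw [← hpair]
      refine integral_congr_ae ?_
      filter_upwards [hw₀, hw₁] with ξ h0 h1
      rw [h0, h1, hψg, Complex.real_smul]
      ring
    · exact (Lp.memLp w₀).integrable_mul (Lp.memLp X)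
    · exact (Lp.memLp w₁).integrable_mul (Lp.memLp Z)
  filter_upwards [hzero] with ξ hξ
  linear_combination hξ

end IsSolution

end

/-! ### Comparison with the free wave -/

section

variable {d : ℕ} {μ₁ μ₂ : ℝ} {u₀ : H1 d} {u₁ : L2 d} {u : ℝ → H1 d} {u' : ℝ → L2 d}

open Complex

lemma gradLI_W (hd : 1 ≤ d) (t : ℝ) (v : HDot1 d × L2 d) :
    gradLI d (W t v).1 =ᵐ[volume] fun ξ => (Real.cos (t * absGrad ξ) : ℂ) * gradLI d v.1 ξ
      + (Real.sin (t * absGrad ξ) : ℂ) * fourierL d v.2 ξ := by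
  have h : gradLI d (W t v).1 = gradLI d (W0 t v.1) + gradLI d (W1 t v.2) := map_add _ _ _
  rw [h]
  filter_upwards [Lp.coeFn_add (gradLI d (W0 t v.1)) (gradLI d (W1 t v.2)), gradLI_ae v.1,
    gradLI_ae_of_ae (memLp_W0 t v.1).coeFn_toLp, gradLI_ae_of_ae (memLp_W1 t v.2).coeFn_toLp,
    ae_absGrad_pos hd] with ξ h1 h2 h3 h4 h5
  have h0 : (absGrad ξ : ℂ) ≠ 0 := ofReal_ne_zero.2 h5.ne'
  rw [h1, Pi.add_apply, h2, W0, W1, h3, h4, fourierL_apply]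
  push_cast
  field_simp

lemma fourierL_W (t : ℝ) (v : HDot1 d × L2 d) :
    fourierL d (W t v).2 =ᵐ[volume] fun ξ => -(Real.sin (t * absGrad ξ) : ℂ) * gradLI d v.1 ξ
      + (Real.cos (t * absGrad ξ) : ℂ) * fourierL d v.2 ξ := by
  have h : fourierL d (W t v).2 = (memLp_dW0 t v.1).toLp + (memLp_dW1 t v.2).toLp := by
    rw [W, map_add, fourierL_apply, fourierL_apply, dW0, dW1, FourierTransform.fourier_fourierInv_eq,
      FourierTransform.fourier_fourierInv_eq]
  rw [h]
  filter_upwards [Lp.coeFn_add ((memLp_dW0 t v.1).toLp : L2 d) (memLp_dW1 t v.2).toLp,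
    gradLI_ae v.1, (memLp_dW0 t v.1).coeFn_toLp, (memLp_dW1 t v.2).coeFn_toLp] with ξ h1 h2 h3 h4
  rw [h1, Pi.add_apply, h2, h3, h4, fourierL_apply]
  push_cast
  ring

lemma phase_one_mul (t : ℝ) (ξ : Space d) :
    phase (1 * t) ξ = Real.cos (t * absGrad ξ) + Real.sin (t * absGrad ξ) * I := by
  rw [one_mul, phase, mul_comm, exp_mul_I, ofReal_cos, ofReal_sin]

lemma phase_neg_one_mul (t : ℝ) (ξ : Space d) :
    phase (-1 * t) ξ = Real.cos (t * absGrad ξ) - Real.sin (t * absGrad ξ) * I := by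
  rw [neg_one_mul, phase, mul_comm, exp_mul_I, ← ofReal_cos, ← ofReal_sin, neg_mul, Real.cos_neg,
    Real.sin_neg, ofReal_neg]
  ring

lemma pullback_ae (P B : ℝ → L2 d) (σ t : ℝ) (z : L2 d) :
    (pullback P B σ t - z : L2 d) =ᵐ[volume]
      fun ξ => phase (σ * t) ξ * (P t ξ - I * σ * B t ξ) - z ξ := by
  filter_upwards [Lp.coeFn_sub (pullback P B σ t) z,
    Lp.coeFn_add (mulL (phase (σ * t)) (P t)) (mulL (fun ξ => (-(I * σ)) * phase (σ * t) ξ) (B t)),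
    mulL_ae (isMultiplier_phase (σ * t)) (P t),
    mulL_ae (isMultiplier_const_mul_phase (-(I * σ)) (σ * t)) (B t)] with ξ h1 h2 h3 h4
  rw [h1, Pi.sub_apply, pullback, h2, Pi.add_apply, h3, h4]
  ring

lemma norm_mulL_phase_le (c : ℂ) (s : ℝ) (f : L2 d) :
    ‖mulL (fun ξ => c * phase s ξ) f‖ ≤ ‖c‖ * ‖f‖ :=
  norm_mulL_le (isMultiplier_const_mul_phase c s)
    (fun ξ => by rw [norm_mul, norm_phase, mul_one]) f

/-- The distance to a free wave, in terms of the pullbacks. -/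
lemma norm_sub_freeWave_le (hd : 1 ≤ d) {P B : ℝ → L2 d} {zp zm : L2 d} {v : HDot1 d × L2 d}
    (hv₁ : gradLI d v.1 =ᵐ[volume] fun ξ => I / 2 * (zp ξ - zm ξ))
    (hv₂ : fourierL d v.2 =ᵐ[volume] fun ξ => 1 / 2 * (zp ξ + zm ξ)) {t r : ℝ}
    (hp : ‖pullback P B 1 t - zp‖ ≤ r) (hm : ‖pullback P B (-1) t - zm‖ ≤ r) :
    ‖B t - gradLI d (W t v).1‖ ≤ r ∧ ‖P t - fourierL d (W t v).2‖ ≤ r := by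
  have hcs : ∀ ξ : Space d, (Real.cos (t * absGrad ξ) : ℂ) ^ 2 + (Real.sin (t * absGrad ξ) : ℂ) ^ 2
      = 1 := fun ξ => by
    rw [← ofReal_pow, ← ofReal_pow, ← ofReal_add, Real.cos_sq_add_sin_sq, ofReal_one]
  have hsum : ∀ a b : ℂ, ‖a‖ = 1 / 2 → ‖b‖ = 1 / 2 →
      ‖mulL (fun ξ => a * phase (-1 * t) ξ) (pullback P B 1 t - zp)
        + mulL (fun ξ => b * phase (1 * t) ξ) (pullback P B (-1) t - zm)‖ ≤ r := by
    intro a b ha hb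
    refine (norm_add_le _ _).trans ?_
    have h1 := norm_mulL_phase_le a (-1 * t) (pullback P B 1 t - zp)
    have h2 := norm_mulL_phase_le b (1 * t) (pullback P B (-1) t - zm)
    rw [ha] at h1
    rw [hb] at h2
    linarith
  have hae : ∀ a b : ℂ, (mulL (fun ξ => a * phase (-1 * t) ξ) (pullback P B 1 t - zp)
        + mulL (fun ξ => b * phase (1 * t) ξ) (pullback P B (-1) t - zm) : L2 d) =ᵐ[volume]
      fun ξ => a * (P t ξ - I * B t ξ) + b * (P t ξ + I * B t ξ)
        - (a * phase (-1 * t) ξ * zp ξ + b * phase (1 * t) ξ * zm ξ) := by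
    intro a b
    filter_upwards [Lp.coeFn_add (mulL (fun ξ => a * phase (-1 * t) ξ) (pullback P B 1 t - zp))
      (mulL (fun ξ => b * phase (1 * t) ξ) (pullback P B (-1) t - zm)),
      mulL_ae (isMultiplier_const_mul_phase a (-1 * t)) (pullback P B 1 t - zp),
      mulL_ae (isMultiplier_const_mul_phase b (1 * t)) (pullback P B (-1) t - zm),
      pullback_ae P B 1 t zp, pullback_ae P B (-1) t zm] with ξ h1 h2 h3 h4 h5
    rw [h1, Pi.add_apply, h2, h3, h4, h5, phase_one_mul, phase_neg_one_mul]
    push_cast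
    set c := cos (t * absGrad ξ)
    set s := sin (t * absGrad ξ)
    have h := hcs ξ
    push_cast at h
    linear_combination (a * (P t ξ - I * B t ξ) + b * (P t ξ + I * B t ξ)) * (h - s ^ 2 * I_sq)
  constructor
  -- The pullbacks Z± = e^{±it|∇|}(P ∓ iB) invert to B = (i/2)(e^{-it|∇|}Z₊ - e^{it|∇|}Z₋) and P =
  -- (e^{-it|∇|}Z₊ + e^{it|∇|}Z₋)/2. The free wave obeys the same formulas with z± in place of Z±,
  -- and the two weights 1/2 add up to one r.
  · have e : B t - gradLI d (W t v).1 = mulL (fun ξ => I / 2 * phase (-1 * t) ξ)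
        (pullback P B 1 t - zp) + mulL (fun ξ => -(I / 2) * phase (1 * t) ξ)
        (pullback P B (-1) t - zm) := by
      refine Lp.ext ?_
      filter_upwards [hae (I / 2) (-(I / 2)), Lp.coeFn_sub (B t) (gradLI d (W t v).1),
        gradLI_W hd t v, hv₁, hv₂] with ξ h1 h2 h3 h4 h5
      rw [h1, h2, Pi.sub_apply, h3, h4, h5, phase_one_mul, phase_neg_one_mul]
      linear_combination (B t ξ - Real.sin (t * absGrad ξ) * (zp ξ + zm ξ) / 2) * I_sq
    rw [e]
    exact hsum _ _ (by simp) (by simp)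
  · have e : P t - fourierL d (W t v).2 = mulL (fun ξ => 1 / 2 * phase (-1 * t) ξ)
        (pullback P B 1 t - zp) + mulL (fun ξ => 1 / 2 * phase (1 * t) ξ)
        (pullback P B (-1) t - zm) := by
      refine Lp.ext ?_
      filter_upwards [hae (1 / 2) (1 / 2), Lp.coeFn_sub (P t) (fourierL d (W t v).2),
        fourierL_W t v, hv₁, hv₂] with ξ h1 h2 h3 h4 h5
      rw [h1, h2, Pi.sub_apply, h3, h4, h5, phase_one_mul, phase_neg_one_mul]
      ring
    rw [e]
    exact hsum _ _ (by simp) (by simp)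

lemma exists_freeWave_data (hd : 1 ≤ d) (zp zm : L2 d) : ∃ v : HDot1 d × L2 d,
    (gradLI d v.1 =ᵐ[volume] fun ξ => I / 2 * (zp ξ - zm ξ)) ∧
    (fourierL d v.2 =ᵐ[volume] fun ξ => 1 / 2 * (zp ξ + zm ξ)) := by
  obtain ⟨F, hF⟩ := exists_gradLI_eq hd ((I / 2) • (zp - zm))
  refine ⟨(F, 𝓕⁻ ((1 / 2 : ℂ) • (zp + zm))), ?_, ?_⟩
  · simp only [hF]
    filter_upwards [Lp.coeFn_smul (I / 2) (zp - zm), Lp.coeFn_sub zp zm] with ξ h1 h2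
    rw [h1, Pi.smul_apply, h2, Pi.sub_apply, smul_eq_mul]
  · simp only [fourierL_apply, FourierTransform.fourier_fourierInv_eq]
    filter_upwards [Lp.coeFn_smul (1 / 2 : ℂ) (zp + zm), Lp.coeFn_add zp zm] with ξ h1 h2
    rw [h1, Pi.smul_apply, h2, Pi.add_apply, smul_eq_mul]

lemma norm_fourierL (f : L2 d) : ‖fourierL d f‖ = ‖f‖ := Lp.norm_fourier_eq f

namespace IsSolution

lemma norm_spectral_zero_le (h : IsSolution μ₁ μ₂ u₀ u₁ u u') :
    ‖spectralY μ₁ u 0‖ + ‖spectralP μ₁ u u' 0‖ ≤ (1 + |μ₁|) * (‖(u₀ : L2 d)‖ + ‖u₁‖) := by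
  have h1 : ‖spectralP μ₁ u u' 0‖ ≤ ‖u₁‖ + |μ₁| / 2 * ‖(u₀ : L2 d)‖ := by
    rw [spectralP, add_zero, Real.one_rpow, one_smul, div_one, h.initial, h.initial_deriv]
    refine (norm_add_le _ _).trans_eq ?_
    rw [norm_smul, norm_fourierL, norm_fourierL, Real.norm_eq_abs, abs_div, abs_two]
  rw [spectralY, add_zero, Real.one_rpow, one_smul, h.initial, norm_fourierL]
  nlinarith [abs_nonneg μ₁, norm_nonneg (u₀ : L2 d), norm_nonneg u₁,
    mul_nonneg (abs_nonneg μ₁) (norm_nonneg (u₀ : L2 d)),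
    mul_nonneg (abs_nonneg μ₁) (norm_nonneg u₁)]

/-- A solution minus the damped free wave, in terms of the spectral solution. -/
lemma norm_toHDot1_sub (μ₁ : ℝ) (u : ℝ → H1 d) {t : ℝ} (ht : 0 ≤ t) (F : HDot1 d) :
    ‖toHDot1 (u t) - (1 + t) ^ (-μ₁ / 2) • F‖
      = (1 + t) ^ (-μ₁ / 2) * ‖spectralB μ₁ u t - gradLI d F‖ := by
  have h1 : 0 < 1 + t := by positivity
  have e : gradLI d (toHDot1 (u t)) = (1 + t) ^ (-μ₁ / 2) • spectralB μ₁ u t := by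
    rw [spectralB, smul_smul, ← Real.rpow_add h1, neg_div, neg_add_cancel, Real.rpow_zero, one_smul]
  rw [← (gradLI d).norm_map, map_sub, map_smul, e, ← smul_sub, norm_smul,
    Real.norm_of_nonneg (by positivity)]

/-- Undoing the transform gives ∂ₜu = (1+t)^{-μ₁/2}(P - μ₁/(2(1+t)) Y). The second term carries no
factor μ and has no counterpart in the bound for u. -/
lemma norm_deriv_sub_le (μ₁ : ℝ) (u : ℝ → H1 d) (u' : ℝ → L2 d) {t : ℝ} (ht : 0 ≤ t) (g : L2 d) :
    ‖u' t - (1 + t) ^ (-μ₁ / 2) • g‖ ≤ (1 + t) ^ (-μ₁ / 2) *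
      (‖spectralP μ₁ u u' t - fourierL d g‖ + |μ₁| / 2 / (1 + t) * ‖spectralY μ₁ u t‖) := by
  have h1 : 0 < 1 + t := by positivity
  have hg : (1 + t) ^ (-μ₁ / 2) * (1 + t) ^ (μ₁ / 2) = 1 := by
    rw [← Real.rpow_add h1, neg_div, neg_add_cancel, Real.rpow_zero]
  have e : fourierL d (u' t) = (1 + t) ^ (-μ₁ / 2) •
      (spectralP μ₁ u u' t - (μ₁ / 2 / (1 + t)) • spectralY μ₁ u t) := by
    rw [spectralP, spectralY, smul_comm (μ₁ / 2 / (1 + t)), ← smul_sub, smul_smul, hg, one_smul,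
      add_sub_cancel_right]
  rw [← norm_fourierL, map_sub, map_smul, e, ← smul_sub, norm_smul,
    Real.norm_of_nonneg (by positivity), sub_right_comm]
  refine mul_le_mul_of_nonneg_left ((norm_sub_le _ _).trans_eq ?_) (by positivity)
  rw [norm_smul, Real.norm_eq_abs, abs_div, abs_div, abs_two, abs_of_pos h1]

end IsSolution

end

end DampedWave

end

/-! ### Conclusion -/

theorem mainTheorem5 (d : ℕ) (hd : 1 ≤ d) (μ₁ μ₂ : ℝ) (hμ : 0 ≤ DampedWave.mass μ₁ μ₂) :
    ∃ C : ℝ, 0 < C ∧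
      ∀ (u₀ : DampedWave.H1 d) (u₁ : DampedWave.L2 d)
        (u : ℝ → DampedWave.H1 d) (u' : ℝ → DampedWave.L2 d),
        DampedWave.IsSolution μ₁ μ₂ u₀ u₁ u u' →
        ∃ v : DampedWave.HDot1 d × DampedWave.L2 d, ∀ t : ℝ, 0 ≤ t →
          ‖DampedWave.toHDot1 (u t) - (1 + t) ^ (-μ₁ / 2) • (DampedWave.W t v).1‖
              ≤ C * DampedWave.mass μ₁ μ₂ * (‖(u₀ : DampedWave.L2 d)‖ + ‖u₁‖)
                * DampedWave.rate (DampedWave.mass μ₁ μ₂) μ₁ t ∧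
          ‖u' t - (1 + t) ^ (-μ₁ / 2) • (DampedWave.W t v).2‖
              ≤ C * (DampedWave.mass μ₁ μ₂ + |μ₁|) * (‖(u₀ : DampedWave.L2 d)‖ + ‖u₁‖)
                * DampedWave.rate (DampedWave.mass μ₁ μ₂) μ₁ t := by
  open DampedWave in
  obtain ⟨C, hC, ⟨Q, hQ, hQ'⟩, hosc⟩ := exists_growth_bound hμ
  -- The factor 2C(1+|μ₁|) is the growth constant times the cost of expressing the data of w through
  -- those of u. In C + 1, the C comes from the tail `Q` and the 1 from the extra |μ₁| term.
  refine ⟨2 * C * (1 + |μ₁|) * (C + 1), by positivity, fun u₀ u₁ u u' h => ?_⟩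
  have hs := h.isSpectralSolution
  set μ := mass μ₁ μ₂
  set D := ‖(u₀ : L2 d)‖ + ‖u₁‖
  have hD : 0 ≤ D := by positivity
  set K := 2 * C * (1 + |μ₁|) * D with hK
  have hK0 : 0 ≤ K := by positivity
  have hY : ∀ t, 0 ≤ t → ‖spectralY μ₁ u t‖ ≤ K * growth μ t := fun t ht => by
    refine (hs.norm_le hd hC hosc ht).trans
      (mul_le_mul_of_nonneg_right ?_ (growth_nonneg μ ht))
    have := mul_le_mul_of_nonneg_left h.norm_spectral_zero_le (by positivity : 0 ≤ 2 * C)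
    rw [hK]
    linarith
  have hlim : ∀ σ : ℝ, |σ| = 1 → ∃ z, ∀ t, 0 ≤ t →
      ‖pullback (spectralP μ₁ u u') (spectralB μ₁ u) σ t - z‖ ≤ K * Q t := fun σ hσ => by
    -- The dominating function is K·`Q`: its decrease matches the L² growth bound times μ/(1+t)².
    refine hs.exists_limit_pullback (R' := fun t => K * (μ / (1 + t) ^ 2 * growth μ t))
      (fun t ht => mul_nonneg hK0 (hQ' t ht).1) (fun t ht => ?_) (fun t ht => ?_) hσ
    · refine ((hQ t ht).const_mul K).congr_deriv ?_
      ring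
    · rw [abs_of_nonneg (by positivity)]
      calc _ ≤ μ / (1 + t) ^ 2 * (K * growth μ t) :=
            mul_le_mul_of_nonneg_left (hY t ht) (by positivity)
        _ = _ := by ring
  obtain ⟨zp, hzp⟩ := hlim 1 abs_one
  obtain ⟨zm, hzm⟩ := hlim (-1) (by rw [abs_neg, abs_one])
  obtain ⟨v, hv₁, hv₂⟩ := exists_freeWave_data hd zp zm
  refine ⟨v, fun t ht => ?_⟩
  obtain ⟨hB, hP⟩ := norm_sub_freeWave_le hd hv₁ hv₂ (hzp t ht) (hzm t ht)
  have h1 : 0 < 1 + t := by positivity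
  have hKQ : K * Q t ≤ K * (C * μ * (growth μ t / (1 + t))) :=
    mul_le_mul_of_nonneg_left (hQ' t ht).2 hK0
  have hg : 0 ≤ growth μ t / (1 + t) := div_nonneg (growth_nonneg μ ht) h1.le
  have hpow : 0 ≤ (1 + t) ^ (-μ₁ / 2) := by positivity
  rw [rate_eq μ μ₁ ht]
  constructor
  · rw [IsSolution.norm_toHDot1_sub μ₁ u ht]
    calc _ ≤ (1 + t) ^ (-μ₁ / 2) * (K * (C * μ * (growth μ t / (1 + t)))) :=
          mul_le_mul_of_nonneg_left (hB.trans hKQ) hpow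
      _ ≤ (1 + t) ^ (-μ₁ / 2) * (K * ((C + 1) * μ * (growth μ t / (1 + t)))) := by
          gcongr
          linarith
      _ = _ := by rw [hK]; ring
  · refine (IsSolution.norm_deriv_sub_le μ₁ u u' ht _).trans ?_
    have hY' : |μ₁| / 2 / (1 + t) * ‖spectralY μ₁ u t‖
        ≤ K * (|μ₁| * (growth μ t / (1 + t))) := by
      calc _ ≤ |μ₁| / 2 / (1 + t) * (K * growth μ t) :=
            mul_le_mul_of_nonneg_left (hY t ht) (by positivity)
        _ = K * (|μ₁| * (growth μ t / (1 + t))) / 2 := by ring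
        _ ≤ _ := half_le_self (by positivity)
    calc _ ≤ (1 + t) ^ (-μ₁ / 2) * (K * (C * μ * (growth μ t / (1 + t)))
            + K * (|μ₁| * (growth μ t / (1 + t)))) :=
          mul_le_mul_of_nonneg_left (add_le_add (hP.trans hKQ) hY') hpow
      _ = (1 + t) ^ (-μ₁ / 2) * (K * ((C * μ + |μ₁|) * (growth μ t / (1 + t)))) := by ring
      _ ≤ (1 + t) ^ (-μ₁ / 2) * (K * ((C + 1) * (μ + |μ₁|) * (growth μ t / (1 + t)))) := by
          gcongr
          nlinarith [mul_nonneg hC.le (abs_nonneg μ₁)]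
      _ = _ := by rw [hK]; ring
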